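/- Let $\mathbb T^2=(\mathbb R/\mathbb Z)^2$, $T>0$, and for a vector field $f$ on $\mathbb T^2$ write $E_f=\frac12\int_{\mathbb T^2}|f|^2\,dx\in[0,\infty]$; for $v$ depending on time write $E_v(t)=E_{v(t)}$. For $\nu>0$ and $v_0\in L^2(\mathbb T^2;\mathbb R^2)$ weakly divergence-free, a *Leray–Hopf solution* of the two-dimensional Navier–Stokes equations with viscosity $\nu$ and datum $v_0$ is a field $v\in L^\infty([0,T];L^2(\mathbb T^2))\cap L^2([0,T];H^1(\mathbb T^2))$, weakly divergence-free for a.e. $t$, such that $$\int_0^T\!\!\int_{\mathbb T^2}\bigl(v\cdot\partial_t\varphi+v\otimes v:\nabla\varphi+\nu\, v\cdot\Delta\varphi\bigr)\,dx\,dt=-\int_{\mathbb T^2}v_0\cdot\varphi(x,0)\,dx$$ for every divergence-free $\varphi\in C^\infty_c(\mathbb T^2\times[0,T);\mathbb R^2)$, and $$E_v(t)+\nu\int_0^t\!\!\int_{\mathbb T^2}|\nabla v(x,s)|^2\,dx\,ds\le E_{v_0}\qquad\text{for a.e. }t\in[0,T].$$ **Proposition.** Let $\nu_j>0$ with $\nu_j\to0$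 along a proper, countably generated filter on the index set (for instance a sequence $\nu_n\to0$, or the whole family $\nu\to0^+$). Let $u^{\nu_j}_0\in L^2(\mathbb T^2;\mathbb R^2)$ be divergence-free with $u_0^{\nu_j}\to u_0$ in $L^2(\mathbb T^2)$, and let $u^{\nu_j}$ be a Leray–Hopf solution with viscosity $\nu_j$ and datum $u_0^{\nu_j}$. Assume that $$\limsup_{j}\ \nu_j\int_0^T\!\!\int_{\mathbb T^2}|\nabla u^{\nu_j}(x,t)|^2\,dx\,dt=0$$ and that $u^{\nu_j}\rightharpoonup u$ weakly in $L^2(\mathbb T^2\times[0,T])$. 1. If $E_u(t)=E_{u_0}$ for a.e. $t\in[0,T]$, then $u^{\nu_j}\to u$ in $L^p([0,T];L^2(\mathbb T^2))$ for all $p\in[1,\infty)$. 2. Conversely, if $u^{\nu_j}\to u$ in $L^1([0,T];L^2(\mathbb T^2))$, then $E_u(t)=E_{u_0}$ for a.e. $t\in[0,T]$. -/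

import Mathlib

open MeasureTheory Filter Topology
open scoped ENNReal ContDiff

/-- The flat two-dimensional torus `(ℝ/ℤ)²`; its `volume` is Lebesgue measure, of total mass one. -/
abbrev Torus2 : Type := UnitAddTorus (Fin 2)

/-- The Euclidean plane, in which velocities take their values. -/
abbrev Plane : Type := EuclideanSpace ℝ (Fin 2)

/-- The covering map `ℝ² → (ℝ/ℤ)²`. -/
def toTorus2 (y : Fin 2 → ℝ) : Torus2 := fun i => (y i : UnitAddCircle)

/-- The classical partial derivative of a function on the torus in the `i`-th direction. -/
noncomputable def torusPartial {F : Type*} [NormedAddCommGroup F] [NormedSpace ℝ F]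
    (i : Fin 2) (f : Torus2 → F) (x : Torus2) : F :=
  deriv (fun s : ℝ => f (x + Pi.single i (s : UnitAddCircle))) 0

/-- The classical Laplacian of a function on the torus. -/
noncomputable def torusLaplacian {F : Type*} [NormedAddCommGroup F] [NormedSpace ℝ F]
    (f : Torus2 → F) (x : Torus2) : F :=
  ∑ i : Fin 2, torusPartial i (torusPartial i f) x

/-- Smooth functions on the torus: those whose periodic lift to `ℝ²` is `C^∞`. -/
def TorusSmooth (ψ : Torus2 → ℝ) : Prop :=
  ContDiff ℝ ∞ (fun y : Fin 2 → ℝ => ψ (toTorus2 y))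

/-- `div f = 0` on the torus in the sense of distributions. -/
def WeakDivFree (f : Torus2 → Plane) : Prop :=
  ∀ ψ : Torus2 → ℝ, TorusSmooth ψ → ∫ x, ∑ i : Fin 2, f x i * torusPartial i ψ x = 0

/-- `g i` is the weak partial derivative `∂ᵢ f` on the torus, for `i = 0, 1`. -/
def IsWeakGradient (f : Torus2 → Plane) (g : Torus2 → Fin 2 → Plane) : Prop :=
  ∀ (i : Fin 2) (ψ : Torus2 → ℝ), TorusSmooth ψ →
    ∫ x, torusPartial i ψ x • f x = - ∫ x, ψ x • g x i

/-- Lebesgue measure on the time interval `[0,T]`. -/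
noncomputable def timeMeasure (T : ℝ) : Measure ℝ := volume.restrict (Set.Icc 0 T)

/-- Lebesgue measure on `[0,T] × 𝕋²`. -/
noncomputable def spaceTimeMeasure (T : ℝ) : Measure (ℝ × Torus2) :=
  (timeMeasure T).prod volume

/-- The norm of `L^p([0,T]; L²(𝕋²))`, with values in `[0,∞]`. -/
noncomputable def normLpL2 (p : ℝ≥0∞) (T : ℝ) (v : ℝ → Torus2 → Plane) : ℝ≥0∞ :=
  eLpNorm (fun t => eLpNorm (v t) 2 volume) p (timeMeasure T)

/-- Membership in `L^p([0,T]; L²(𝕋²))`. -/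
def MemLpL2 (p : ℝ≥0∞) (T : ℝ) (v : ℝ → Torus2 → Plane) : Prop :=
  AEStronglyMeasurable (fun q : ℝ × Torus2 => v q.1 q.2) (spaceTimeMeasure T) ∧
    normLpL2 p T v < ⊤

/-- The kinetic energy `(1/2) ∫ |f|² dx`, with values in `[0,∞]`. -/
noncomputable def kineticEnergy (f : Torus2 → Plane) : ℝ≥0∞ :=
  2⁻¹ * ∫⁻ x, ‖f x‖ₑ ^ 2

/-- The energy `ν ∫₀ᵗ ∫ |∇u|² dx ds` dissipated up to time `t`, where `Du` is the gradient of `u`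
and `|∇u|² = ∑ᵢⱼ |∂ᵢ uⱼ|²`. -/
noncomputable def dissipation (ν t : ℝ) (Du : ℝ → Torus2 → Fin 2 → Plane) : ℝ≥0∞ :=
  ENNReal.ofReal ν * ∫⁻ s in Set.Icc 0 t, ∫⁻ x, ∑ i : Fin 2, ‖Du s x i‖ₑ ^ 2

/-- Divergence-free test fields in `C^∞_c(𝕋² × [0,T))`. They need not vanish at time `0`. -/
structure IsTestField (T : ℝ) (φ : ℝ → Torus2 → Plane) : Prop where
  smooth : ContDiff ℝ ∞ (fun q : ℝ × (Fin 2 → ℝ) => φ q.1 (toTorus2 q.2))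
  support : ∃ S < T, ∀ t ≥ S, ∀ x, φ t x = 0
  div_free : ∀ t x, ∑ i : Fin 2, torusPartial i (fun y => φ t y i) x = 0

/-- `u` is a Leray–Hopf weak solution of the Navier–Stokes equations with viscosity `ν` on
`𝕋² × (0,T)` with initial datum `u₀`, and `Du` is its weak spatial gradient (which `u` determines
almost everywhere). -/
structure IsLerayHopf (ν T : ℝ) (u₀ : Torus2 → Plane) (u : ℝ → Torus2 → Plane)
    (Du : ℝ → Torus2 → Fin 2 → Plane) : Prop where
  init_memLp : MemLp u₀ 2 volume
  init_div_free : WeakDivFree u₀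
  /-- `u ∈ L^∞([0,T]; L²)` -/
  mem_LinftyL2 : MemLpL2 ⊤ T u
  /-- `u ∈ L²([0,T]; H¹)` -/
  gradient : ∀ᵐ t ∂timeMeasure T, IsWeakGradient (u t) (Du t)
  gradient_mem : ∀ i : Fin 2, MemLpL2 2 T (fun t x => Du t x i)
  div_free : ∀ᵐ t ∂timeMeasure T, WeakDivFree (u t)
  /-- The weak form of the equations, with
  `u ⊗ u : ∇φ = ∑ᵢ uᵢ (u · ∂ᵢφ)`. -/
  weak_form : ∀ φ : ℝ → Torus2 → Plane, IsTestField T φ →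
    ∫ t in Set.Icc 0 T, ∫ x,
      (inner ℝ (u t x) (deriv (fun s => φ s x) t)
        + ∑ i : Fin 2, u t x i * inner ℝ (u t x) (torusPartial i (φ t) x)
        + ν * inner ℝ (u t x) (torusLaplacian (φ t) x))
      = - ∫ x, inner ℝ (u₀ x) (φ 0 x)
  /-- The energy inequality. -/
  energy_le : ∀ᵐ t ∂timeMeasure T,
    kineticEnergy (u t) + dissipation ν t Du ≤ kineticEnergy u₀

/-- Weak convergence `v j ⇀ w` in `L²(𝕋² × [0,T])` along the filter `l`. -/
def WeakTendstoL2 {ι : Type*} (T : ℝ) (l : Filter ι) (v : ι → ℝ → Torus2 → Plane)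
    (w : ℝ → Torus2 → Plane) : Prop :=
  ∀ g : ℝ × Torus2 → Plane, MemLp g 2 (spaceTimeMeasure T) →
    Tendsto (fun j => ∫ q, inner ℝ (v j q.1 q.2) (g q) ∂spaceTimeMeasure T) l
      (𝓝 (∫ q, inner ℝ (w q.1 q.2) (g q) ∂spaceTimeMeasure T))

/-! The first implication is the Hilbert space principle that weak convergence without loss of norm
is strong. The energy inequality bounds the space-time `L²` norms of `u^{ν_j}` by the energies of
the data. These converge to the energy of `u₀`, which is that of `u` at almost every time. Expanding
`‖u^{ν_j} - u‖²` and testing the weak convergence with `u` itself gives strong convergence in `L²`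
(`tendsto_eLpNorm_spaceTime`). The `L^∞L²` bound then gives every finite `p`
(`tendsto_eLpNorm_of_bounded`).

For the converse, pass to a subsequence converging in `L²(𝕋²)` at almost every time. The energy
inequality gives `E_u(t) ≤ E_{u₀}`. The opposite bound needs `E_{u₀} ≤ E(t) +` dissipation for each
Leray–Hopf solution (`IsLerayHopf.ae_le_energy`); the dissipation then vanishes in the limit. This
reverse inequality is the two-dimensional fact that carries most of the work.

A Leray–Hopf solution is not an admissible test field, so the energy balance is written for finitely
many Fourier modes. Testing with single solenoidal modes gives an integral equation for each
coefficient (`IsLerayHopf.ae_mode_eq`); squaring and summing gives the balance of the truncated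
energy, with error `∫ v ⊗ v : ∇Pv` (`IsLerayHopf.ae_modeEnergy_eq`). Incompressibility replaces one
factor `v` by the remainder `v - Pv` (`transport_eq`), and Hölder's inequality with exponents 4, 4,
2 applies. Ladyzhenskaya's inequality `‖f‖₄² ≤ ‖f‖₂² + 2‖f‖₂ ∑ᵢ‖∂ᵢf‖₂`, proved from the
one-dimensional estimate on coordinate lines, makes the error tend to zero at almost every time and
dominates it by an integrable function of time. Dominated convergence removes it
(`IsLerayHopf.tendsto_lintegral_transport`). -/

/-! ### Real trigonometric polynomials and their derivatives. -/

/-- The real trigonometric monomial `Re (z e^{2πi k·x})` on the torus. -/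
noncomputable def trig (k : Fin 2 → ℤ) (z : ℂ) (x : Torus2) : ℝ :=
  (z * UnitAddTorus.mFourier k x).re

/-- The trigonometric polynomial with coefficients `c k`, for `k ∈ F`. -/
noncomputable def trigSum (F : Finset (Fin 2 → ℤ)) (c : (Fin 2 → ℤ) → ℂ) (x : Torus2) : ℝ :=
  ∑ k ∈ F, trig k (c k) x

/-- The Fourier coefficients of a real function on the torus. -/
noncomputable def coef (f : Torus2 → ℝ) (k : Fin 2 → ℤ) : ℂ :=
  ⟨∫ x, f x * trig k 1 x, ∫ x, f x * trig k Complex.I x⟩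

/-- The Fourier multiplier of `∂ᵢ`. -/
noncomputable def derivCoef (i : Fin 2) (c : (Fin 2 → ℤ) → ℂ) (k : Fin 2 → ℤ) : ℂ :=
  (2 * Real.pi * k i : ℝ) * (Complex.I * c k)

/-- The partial sum of the Fourier series over the frequencies in `F`. -/
noncomputable def trunc (F : Finset (Fin 2 → ℤ)) (f : Torus2 → ℝ) : Torus2 → ℝ :=
  trigSum F (coef f)

theorem continuous_trig (k : Fin 2 → ℤ) (z : ℂ) : Continuous (trig k z) := by
  unfold trig; fun_prop

theorem continuous_trigSum (F : Finset (Fin 2 → ℤ)) (c : (Fin 2 → ℤ) → ℂ) :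
    Continuous (trigSum F c) :=
  continuous_finsetSum _ fun k _ => continuous_trig k (c k)

theorem trig_eq (k : Fin 2 → ℤ) (z : ℂ) (x : Torus2) :
    trig k z x = z.re * trig k 1 x + z.im * trig k Complex.I x := by
  simp [trig, Complex.mul_re]; ring

theorem abs_trig_le (k : Fin 2 → ℤ) (z : ℂ) (x : Torus2) : |trig k z x| ≤ ‖z‖ := by
  refine (Complex.abs_re_le_norm _).trans ?_
  rw [norm_mul]
  have := (UnitAddTorus.mFourier k).norm_coe_le_norm x
  rw [UnitAddTorus.mFourier_norm] at this
  exact mul_le_of_le_one_right (norm_nonneg _) this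

theorem mFourier_toTorus2 (k : Fin 2 → ℤ) (y : Fin 2 → ℝ) :
    UnitAddTorus.mFourier k (toTorus2 y)
      = ∏ i, Complex.exp (2 * Real.pi * Complex.I * k i * y i) := by
  simp [UnitAddTorus.mFourier, toTorus2]

theorem torusSmooth_trig (k : Fin 2 → ℤ) (z : ℂ) : TorusSmooth (trig k z) := by
  have h : (fun y : Fin 2 → ℝ => trig k z (toTorus2 y)) = fun y =>
      Complex.reCLM (z * ∏ i,
        Complex.exp (2 * Real.pi * Complex.I * k i * Complex.ofRealCLM (y i))) := by
    funext y; simp only [trig, mFourier_toTorus2]; rfl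
  rw [TorusSmooth, h]
  fun_prop

theorem mFourier_add_single (k : Fin 2 → ℤ) (i : Fin 2) (x : Torus2) (s : ℝ) :
    UnitAddTorus.mFourier k (x + Pi.single i (s : UnitAddCircle))
      = UnitAddTorus.mFourier k x * Complex.exp (2 * Real.pi * Complex.I * k i * s) := by
  have hadd : ∀ (n : ℤ) (a b : UnitAddCircle), fourier n (a + b) = fourier n a * fourier n b := by
    intro n a b
    simp only [fourier_apply, smul_add, AddCircle.toCircle_add, Circle.coe_mul]
  have hs : fourier (k i) (s : UnitAddCircle) = Complex.exp (2 * Real.pi * Complex.I * k i * s) := by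
    simp [fourier_coe_apply (T := 1) (n := k i) (x := s)]
  rw [← hs]
  fin_cases i <;>
  simp only [UnitAddTorus.mFourier, Fin.prod_univ_two, ContinuousMap.coe_mk, Pi.add_apply, hadd,
    Fin.zero_eta, Fin.mk_one, Pi.single_eq_same, ne_eq, one_ne_zero, zero_ne_one,
    not_false_eq_true, Pi.single_eq_of_ne, fourier_eval_zero, mul_one]
  all_goals ring

theorem hasDerivAt_trig (k : Fin 2 → ℤ) (z : ℂ) (i : Fin 2) (x : Torus2) (r : ℝ) :
    HasDerivAt (fun s : ℝ => trig k z (x + Pi.single i (s : UnitAddCircle)))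
      (trig k ((2 * Real.pi * k i : ℝ) * (Complex.I * z)) (x + Pi.single i (r : UnitAddCircle)))
      r := by
  simp only [trig, mFourier_add_single]
  have h : HasDerivAt (fun s : ℝ => z * (UnitAddTorus.mFourier k x *
      Complex.exp (2 * Real.pi * Complex.I * k i * s)))
      (z * (UnitAddTorus.mFourier k x * (Complex.exp (2 * Real.pi * Complex.I * k i * r) *
        (2 * Real.pi * Complex.I * k i * 1)))) r :=
    ((((Complex.ofRealCLM.hasDerivAt (x := r)).const_mul _).cexp).const_mul _).const_mul _
  refine (Complex.reCLM.hasFDerivAt.comp_hasDerivAt r h).congr_deriv ?_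
  refine congrArg Complex.re ?_
  push_cast
  ring

theorem torusSmooth_trigSum (F : Finset (Fin 2 → ℤ)) (c : (Fin 2 → ℤ) → ℂ) :
    TorusSmooth (trigSum F c) :=
  ContDiff.sum fun k _ => torusSmooth_trig k (c k)

theorem hasDerivAt_trigSum (F : Finset (Fin 2 → ℤ)) (c : (Fin 2 → ℤ) → ℂ) (i : Fin 2)
    (x : Torus2) (r : ℝ) :
    HasDerivAt (fun s : ℝ => trigSum F c (x + Pi.single i (s : UnitAddCircle)))
      (trigSum F (derivCoef i c) (x + Pi.single i (r : UnitAddCircle))) r :=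
  HasDerivAt.fun_sum fun k _ => hasDerivAt_trig k (c k) i x r

theorem torusPartial_trig (k : Fin 2 → ℤ) (z : ℂ) (i : Fin 2) :
    torusPartial i (trig k z) = trig k ((2 * Real.pi * k i : ℝ) * (Complex.I * z)) := by
  funext x
  simpa [torusPartial] using (hasDerivAt_trig k z i x 0).deriv

theorem trig_ofReal_mul (k : Fin 2 → ℤ) (a : ℝ) (z : ℂ) (x : Torus2) :
    trig k (a * z) x = a * trig k z x := by
  simp [trig, mul_assoc]

theorem torusLaplacian_trig (k : Fin 2 → ℤ) (z : ℂ) (x : Torus2) :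
    torusLaplacian (trig k z) x = -(4 * Real.pi ^ 2 * ∑ i, (k i : ℝ) ^ 2) * trig k z x := by
  simp only [torusLaplacian, torusPartial_trig, ← trig_ofReal_mul, Fin.sum_univ_two]
  simp only [trig, ← Complex.add_re, ← add_mul]
  congr 2
  push_cast
  linear_combination (4 * Real.pi ^ 2 * (k 0 ^ 2 + k 1 ^ 2) * z : ℂ) * Complex.I_sq

/-! ### Fourier series in `L²` of the torus. -/

theorem volume_torus2_eq :
    (volume : Measure Torus2) = Measure.pi fun _ : Fin 2 => AddCircle.haarAddCircle := by
  rw [volume_pi]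
  congr 1
  funext i
  rw [AddCircle.volume_eq_smul_haarAddCircle]
  simp

instance : IsProbabilityMeasure (volume : Measure Torus2) := by
  rw [volume_torus2_eq]; infer_instance

theorem exists_hilbertBasis_mFourier :
    ∃ b : HilbertBasis (Fin 2 → ℤ) ℂ (Lp ℂ 2 (volume : Measure Torus2)),
      ∀ k, b k =ᵐ[volume] UnitAddTorus.mFourier k := by
  rw [volume_torus2_eq]
  refine ⟨UnitAddTorus.mFourierBasis (d := Fin 2), fun k => ?_⟩
  rw [UnitAddTorus.coe_mFourierBasis]
  exact UnitAddTorus.coeFn_mFourierLp 2 k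

theorem integrable_mul_trig {f : Torus2 → ℝ} (hf : Integrable f volume) (k : Fin 2 → ℤ) (z : ℂ) :
    Integrable (fun x => f x * trig k z x) volume :=
  hf.mul_bdd (continuous_trig k z).aestronglyMeasurable (ae_of_all _ fun x => abs_trig_le k z x)

theorem integral_mul_trig {f : Torus2 → ℝ} (hf : Integrable f volume) (k : Fin 2 → ℤ) (z : ℂ) :
    ∫ x, f x * trig k z x = z.re * (coef f k).re + z.im * (coef f k).im := by
  simp only [trig_eq k z, mul_add, coef]
  rw [integral_add, ← integral_const_mul, ← integral_const_mul]
  · congr 1 <;> refine integral_congr_ae (ae_of_all _ fun x => ?_) <;> ring_nf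
  · simpa only [mul_left_comm] using (integrable_mul_trig hf k 1).const_mul z.re
  · simpa only [mul_left_comm] using (integrable_mul_trig hf k Complex.I).const_mul z.im

theorem coef_eq_integral {f : Torus2 → ℝ} (hf : Integrable f volume) (k : Fin 2 → ℤ) :
    coef f k = ∫ x, (f x : ℂ) * (starRingEnd ℂ) (UnitAddTorus.mFourier k x) := by
  have hi : Integrable (fun x => (f x : ℂ) * (starRingEnd ℂ) (UnitAddTorus.mFourier k x))
      volume := by
    refine hf.ofReal.mul_bdd (c := 1) (by fun_prop) (ae_of_all _ fun x => ?_)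
    rw [RCLike.norm_conj]
    exact ((UnitAddTorus.mFourier k).norm_coe_le_norm x).trans UnitAddTorus.mFourier_norm.le
  apply Complex.ext
  · refine Eq.trans ?_ (Complex.reCLM.integral_comp_comm hi)
    simp [coef, trig]
  · refine Eq.trans ?_ (Complex.imCLM.integral_comp_comm hi)
    simp [coef, trig]

/-- The complexification of a square integrable function, its Fourier expansion and the
orthonormality of the monomials. -/
theorem exists_fourier_expansion {f : Torus2 → ℝ} (hf : MemLp f 2 volume) :
    ∃ (b : HilbertBasis (Fin 2 → ℤ) ℂ (Lp ℂ 2 (volume : Measure Torus2)))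
      (φ : Lp ℂ 2 (volume : Measure Torus2)),
      (∀ k, b k =ᵐ[volume] UnitAddTorus.mFourier k) ∧ (φ =ᵐ[volume] fun x => (f x : ℂ)) ∧
      (∀ k, b.repr φ k = coef f k) ∧ ‖φ‖ₑ = eLpNorm f 2 volume := by
  obtain ⟨b, hb⟩ := exists_hilbertBasis_mFourier
  have hf' : MemLp (fun x => (f x : ℂ)) 2 volume := hf.ofReal
  refine ⟨b, hf'.toLp, hb, hf'.coeFn_toLp, fun k => ?_, ?_⟩
  · rw [b.repr_apply_apply, L2.inner_def, coef_eq_integral (hf.integrable (by norm_num))]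
    refine integral_congr_ae ?_
    filter_upwards [hb k, hf'.coeFn_toLp] with x h1 h2
    rw [h1, h2]
    simp
  · rw [Lp.enorm_toLp]
    exact eLpNorm_congr_norm_ae (ae_of_all _ fun x => by simp)

theorem coeFn_sum_eq {b : HilbertBasis (Fin 2 → ℤ) ℂ (Lp ℂ 2 (volume : Measure Torus2))}
    (hb : ∀ k, b k =ᵐ[volume] UnitAddTorus.mFourier k) (F : Finset (Fin 2 → ℤ))
    (c : (Fin 2 → ℤ) → ℂ) :
    (∑ k ∈ F, c k • b k : Lp ℂ 2 (volume : Measure Torus2))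
      =ᵐ[volume] fun x => ∑ k ∈ F, c k * UnitAddTorus.mFourier k x := by
  have h : ∀ᵐ x ∂(volume : Measure Torus2), ∀ k ∈ F,
      (c k • b k : Lp ℂ 2 (volume : Measure Torus2)) x = c k * UnitAddTorus.mFourier k x := by
    refine (ae_ball_iff F.countable_toSet).2 ?_
    intro k _
    filter_upwards [hb k, Lp.coeFn_smul (c k) (b k)] with x h1 h2
    rw [h2, Pi.smul_apply, h1, smul_eq_mul]
  filter_upwards [h, Lp.coeFn_finsetSum F (fun k => c k • b k)] with x h1 h2
  rw [h2, Finset.sum_apply]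
  exact Finset.sum_congr rfl h1

/-- The frequency set need not be symmetric: `f` is real, so `f - trunc F f` is the real part of the
complex remainder, whose norm tends to zero. -/
theorem tendsto_eLpNorm_sub_trunc {f : Torus2 → ℝ} (hf : MemLp f 2 volume) :
    Tendsto (fun F => eLpNorm (fun x => f x - trunc F f x) 2 volume) atTop (𝓝 0) := by
  obtain ⟨b, φ, hb, hφ, hc, -⟩ := exists_fourier_expansion hf
  have hs : Tendsto (fun F : Finset (Fin 2 → ℤ) => ‖φ - ∑ k ∈ F, coef f k • b k‖ₑ) atTop
      (𝓝 0) := by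
    have := b.hasSum_repr φ
    simp only [hc] at this
    have h2 := (Filter.Tendsto.const_sub φ this).enorm
    simpa using h2
  refine tendsto_of_tendsto_of_tendsto_of_le_of_le tendsto_const_nhds hs (fun _ => zero_le)
    fun F => ?_
  rw [Lp.enorm_def]
  refine eLpNorm_mono_ae ?_
  filter_upwards [Lp.coeFn_sub φ (∑ k ∈ F, coef f k • b k), coeFn_sum_eq hb F (coef f), hφ]
    with x h1 h2 h3
  rw [h1, Pi.sub_apply, h2, h3]
  have : f x - trunc F f x = ((f x : ℂ) - ∑ k ∈ F, coef f k * UnitAddTorus.mFourier k x).re := by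
    simp [trunc, trigSum, trig]
  rw [this]
  exact Complex.abs_re_le_norm _

theorem hasSum_sq_coef {f : Torus2 → ℝ} (hf : MemLp f 2 volume) :
    HasSum (fun k => ‖coef f k‖ ^ 2) ((eLpNorm f 2 volume).toReal ^ 2) := by
  obtain ⟨b, φ, hb, hφ, hc, hn⟩ := exists_fourier_expansion hf
  have := lp.hasSum_norm (p := 2) (by norm_num) (b.repr φ)
  simp only [hc, LinearIsometryEquiv.norm_map] at this
  rw [← hn, toReal_enorm]
  simpa using this

/-- Taking real parts does not increase the norm of the complex partial sum, to which Bessel's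
inequality applies. -/
theorem eLpNorm_trunc_le {f : Torus2 → ℝ} (hf : MemLp f 2 volume) (F : Finset (Fin 2 → ℤ)) :
    eLpNorm (trunc F f) 2 volume ≤ eLpNorm f 2 volume := by
  obtain ⟨b, φ, hb, hφ, hc, hn⟩ := exists_fourier_expansion hf
  calc eLpNorm (trunc F f) 2 volume ≤ ‖∑ k ∈ F, coef f k • b k‖ₑ := by
        rw [Lp.enorm_def]
        refine eLpNorm_mono_ae ?_
        filter_upwards [coeFn_sum_eq hb F (coef f)] with x h2
        rw [h2]
        have : trunc F f x = (∑ k ∈ F, coef f k * UnitAddTorus.mFourier k x).re := by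
          simp [trunc, trigSum, trig]
        rw [this]
        exact Complex.abs_re_le_norm _
    _ ≤ ‖φ‖ₑ := by
        rw [enorm_le_iff_norm_le]
        refine abs_le_of_sq_le_sq' ?_ (norm_nonneg _) |>.2
        have h1 : ‖∑ k ∈ F, coef f k • b k‖ ^ 2 = ∑ k ∈ F, ‖coef f k‖ ^ 2 := by
          rw [@norm_sq_eq_re_inner ℂ, b.orthonormal.inner_sum]
          simp [← Complex.normSq_eq_conj_mul_self, Complex.normSq_eq_norm_sq, -Complex.ofReal_pow]
        rw [h1]
        have := lp.hasSum_norm (p := 2) (by norm_num) (b.repr φ)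
        simp only [hc, LinearIsometryEquiv.norm_map] at this
        norm_num at this
        exact sum_le_hasSum F (fun _ _ => by positivity) this
    _ = eLpNorm f 2 volume := hn

/-! ### Ladyzhenskaya's inequality. -/

/-- The fundamental theorem of calculus gives `φ 0 ≤ φ r + ∫ |φ'|` for each `r` in the unit
interval; averaging over `r` removes the choice of base point. -/
theorem le_integral_add_abs_deriv {φ φ' : ℝ → ℝ} (hφ : ∀ r, HasDerivAt φ (φ' r) r)
    (hφ' : Continuous φ') : φ 0 ≤ ∫ r in (0 : ℝ)..1, (φ r + |φ' r|) := by
  have hc : Continuous φ := continuous_iff_continuousAt.2 fun r => (hφ r).continuousAt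
  have hpt : ∀ r ∈ Set.Icc (0 : ℝ) 1, φ 0 ≤ φ r + ∫ s in (0 : ℝ)..1, |φ' s| := by
    intro r hr
    have h1 : ∫ s in (0 : ℝ)..r, φ' s = φ r - φ 0 :=
      intervalIntegral.integral_eq_sub_of_hasDerivAt (fun s _ => hφ s) (hφ'.intervalIntegrable _ _)
    have h2 : |∫ s in (0 : ℝ)..r, φ' s| ≤ ∫ s in (0 : ℝ)..r, |φ' s| :=
      intervalIntegral.abs_integral_le_integral_abs hr.1
    have h3 : ∫ s in (0 : ℝ)..r, |φ' s| ≤ ∫ s in (0 : ℝ)..1, |φ' s| :=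
      intervalIntegral.integral_mono_interval le_rfl hr.1 hr.2
        (ae_of_all _ fun _ => abs_nonneg _) (hφ'.abs.intervalIntegrable _ _)
    have := neg_le_abs (∫ s in (0 : ℝ)..r, φ' s)
    linarith
  have h := intervalIntegral.integral_mono_on (μ := volume) zero_le_one
    (intervalIntegrable_const (c := φ 0))
    ((show Continuous fun r => φ r + ∫ s in (0 : ℝ)..1, |φ' s| by fun_prop).intervalIntegrable _ _)
    hpt
  rw [intervalIntegral.integral_add (hc.intervalIntegrable _ _) intervalIntegrable_const] at h
  rw [intervalIntegral.integral_add (hc.intervalIntegrable _ _) (hφ'.abs.intervalIntegrable _ _)]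
  simpa using h

theorem lintegral_add_single (G : Torus2 → ℝ≥0∞) (x : Torus2) (i : Fin 2) :
    ∫⁻ r in Set.Ioc (0 : ℝ) 1, G (x + Pi.single i (r : UnitAddCircle))
      = ∫⁻ s : UnitAddCircle, G (Function.update x i s) := by
  have h := UnitAddCircle.lintegral_preimage 0 fun θ => G (x + Pi.single i θ)
  rw [zero_add] at h
  rw [h, ← lintegral_add_left_eq_self (fun s => G (Function.update x i s)) (x i)]
  refine lintegral_congr fun θ => ?_
  congr 1
  funext j
  by_cases hj : j = i
  · subst hj; simp
  · simp [hj]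

/-- The density controlling the square of a function along the coordinate lines. -/
noncomputable def lineDensity (F : Finset (Fin 2 → ℤ)) (c : (Fin 2 → ℤ) → ℂ) (x : Torus2) :
    ℝ≥0∞ :=
  ‖trigSum F c x‖ₑ ^ 2 + ∑ i : Fin 2, 2 * (‖trigSum F c x‖ₑ * ‖trigSum F (derivCoef i c) x‖ₑ)

/-- The one-dimensional estimate is applied to the square of the polynomial along a closed
coordinate line. Summing both partial derivatives in `lineDensity` lets the same density serve both
directions. -/
theorem enorm_sq_le_lintegral_line (F : Finset (Fin 2 → ℤ)) (c : (Fin 2 → ℤ) → ℂ) (x : Torus2)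
    (i : Fin 2) :
    ‖trigSum F c x‖ₑ ^ 2 ≤ ∫⁻ s : UnitAddCircle, lineDensity F c (Function.update x i s) := by
  rw [← lintegral_add_single]
  have hline : Continuous fun r : ℝ => x + (Pi.single i (r : UnitAddCircle) : Torus2) :=
    continuous_const.add ((continuous_single i).comp (AddCircle.continuous_mk' 1))
  have hd : ∀ r : ℝ, HasDerivAt
      (fun s : ℝ => trigSum F c (x + Pi.single i (s : UnitAddCircle)) ^ 2)
      (2 * (trigSum F c (x + Pi.single i (r : UnitAddCircle)) *
        trigSum F (derivCoef i c) (x + Pi.single i (r : UnitAddCircle)))) r := fun r => by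
    refine ((hasDerivAt_trigSum F c i x r).pow 2).congr_deriv ?_
    ring
  have hc : Continuous fun r : ℝ => trigSum F c (x + Pi.single i (r : UnitAddCircle)) :=
    (continuous_trigSum F c).comp hline
  have hc' : Continuous fun r : ℝ => 2 * (trigSum F c (x + Pi.single i (r : UnitAddCircle)) *
        trigSum F (derivCoef i c) (x + Pi.single i (r : UnitAddCircle))) :=
    (hc.mul ((continuous_trigSum F (derivCoef i c)).comp hline)).const_mul 2
  have h := le_integral_add_abs_deriv hd hc'
  simp only [AddCircle.coe_zero, Pi.single_zero, add_zero] at h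
  rw [intervalIntegral.integral_of_le zero_le_one] at h
  have hpos : ∀ r : ℝ, 0 ≤ trigSum F c (x + Pi.single i (r : UnitAddCircle)) ^ 2 +
      |2 * (trigSum F c (x + Pi.single i (r : UnitAddCircle)) *
        trigSum F (derivCoef i c) (x + Pi.single i (r : UnitAddCircle)))| := fun r => by positivity
  calc ‖trigSum F c x‖ₑ ^ 2 = ENNReal.ofReal (trigSum F c x ^ 2) := by
        rw [← enorm_pow, Real.enorm_of_nonneg (by positivity)]
    _ ≤ _ := ENNReal.ofReal_le_ofReal h
    _ = _ := ofReal_integral_eq_lintegral_ofReal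
        (((hc.pow 2).add hc'.abs).integrableOn_Ioc) (ae_of_all _ hpos)
    _ ≤ _ := by
        refine lintegral_mono fun r => ?_
        rw [ENNReal.ofReal_add (by positivity) (by positivity), lineDensity,
          ← Real.enorm_eq_ofReal_abs, ← Real.enorm_of_nonneg (by positivity), enorm_pow, enorm_mul,
          enorm_mul, Real.enorm_of_nonneg zero_le_two, ENNReal.ofReal_ofNat]
        generalize x + Pi.single i (r : UnitAddCircle) = y
        gcongr
        exact Finset.single_le_sum_of_canonicallyOrdered (f := fun j =>
          2 * (‖trigSum F c y‖ₑ * ‖trigSum F (derivCoef j c) y‖ₑ)) (Finset.mem_univ i)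

theorem measurable_lineDensity (F : Finset (Fin 2 → ℤ)) (c : (Fin 2 → ℤ) → ℂ) :
    Measurable (lineDensity F c) := by
  have h0 := (continuous_trigSum F c).measurable
  have h1 := fun i => (continuous_trigSum F (derivCoef i c)).measurable
  exact (h0.enorm.pow_const 2).add
    (Finset.measurable_fun_sum _ fun i _ => (h0.enorm.mul (h1 i).enorm).const_mul 2)

/-- Write the fourth power as a product of two squares and bound each by the line integral in one
direction. The grid-lines inequality then applies; in dimension two its exponent `1 / (n - 1)` is 1,
and it reduces to Tonelli. -/
theorem lintegral_enorm_pow_four_le (F : Finset (Fin 2 → ℤ)) (c : (Fin 2 → ℤ) → ℂ) :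
    ∫⁻ x, ‖trigSum F c x‖ₑ ^ 4 ≤ (∫⁻ x, lineDensity F c x) ^ 2 := by
  have hp : Real.HolderConjugate (Fintype.card (Fin 2) : ℝ) 2 := by
    rw [Fintype.card_fin]; exact_mod_cast Real.HolderConjugate.two_two
  have h := lintegral_prod_lintegral_pow_le (fun _ : Fin 2 => (volume : Measure UnitAddCircle)) hp
    (measurable_lineDensity F c)
  rw [← volume_pi] at h
  simp only [Fintype.card_fin, Nat.cast_ofNat, show (1 : ℝ) / (2 - 1) = 1 by norm_num,
    ENNReal.rpow_one, ENNReal.rpow_ofNat, Fin.prod_univ_two] at h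
  refine le_trans (lintegral_mono fun x => ?_) h
  change ‖trigSum F c x‖ₑ ^ 4 ≤ _
  rw [show 4 = 2 + 2 from rfl, pow_add]
  exact mul_le_mul' (enorm_sq_le_lintegral_line F c x 0) (enorm_sq_le_lintegral_line F c x 1)

theorem eLpNorm_natCast_pow {α E : Type*} [MeasurableSpace α] [NormedAddCommGroup E]
    (μ : Measure α) (f : α → E) {n : ℕ} (hn : n ≠ 0) :
    eLpNorm f n μ ^ n = ∫⁻ x, ‖f x‖ₑ ^ n ∂μ := by
  simpa using eLpNorm_nnreal_pow_eq_lintegral (f := f) (μ := μ) (p := n) (by exact_mod_cast hn)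

theorem eLpNorm_sq_eq_lintegral {α E : Type*} [MeasurableSpace α] [NormedAddCommGroup E]
    (μ : Measure α) (f : α → E) : eLpNorm f 2 μ ^ 2 = ∫⁻ x, ‖f x‖ₑ ^ 2 ∂μ := by
  simpa using eLpNorm_natCast_pow μ f two_ne_zero

theorem lintegral_enorm_mul_le {α : Type*} [MeasurableSpace α] {μ : Measure α} {f g : α → ℝ}
    (hf : AEStronglyMeasurable f μ) (hg : AEStronglyMeasurable g μ) :
    ∫⁻ x, ‖f x‖ₑ * ‖g x‖ₑ ∂μ ≤ eLpNorm f 2 μ * eLpNorm g 2 μ := by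
  have := ENNReal.lintegral_mul_le_Lp_mul_Lq μ Real.HolderConjugate.two_two hf.enorm hg.enorm
  rw [eLpNorm_eq_lintegral_rpow_enorm_toReal two_ne_zero ENNReal.ofNat_ne_top,
    eLpNorm_eq_lintegral_rpow_enorm_toReal two_ne_zero ENNReal.ofNat_ne_top, ENNReal.toReal_ofNat]
  exact this

theorem lintegral_lineDensity_le (F : Finset (Fin 2 → ℤ)) (c : (Fin 2 → ℤ) → ℂ) :
    ∫⁻ x, lineDensity F c x ≤ eLpNorm (trigSum F c) 2 volume ^ 2
      + 2 * (eLpNorm (trigSum F c) 2 volume *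
        ∑ i : Fin 2, eLpNorm (trigSum F (derivCoef i c)) 2 volume) := by
  have h0 := (continuous_trigSum F c).measurable
  have h1 := fun i => (continuous_trigSum F (derivCoef i c)).measurable
  have h2 : ∀ i, Measurable fun x => ‖trigSum F c x‖ₑ * ‖trigSum F (derivCoef i c) x‖ₑ :=
    fun i => h0.enorm.mul (h1 i).enorm
  have h3 : ∀ i, Measurable fun x => 2 * (‖trigSum F c x‖ₑ * ‖trigSum F (derivCoef i c) x‖ₑ) :=
    fun i => (h2 i).const_mul 2
  simp only [lineDensity]
  rw [lintegral_add_left (h0.enorm.pow_const 2),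
    lintegral_finsetSum _ fun i _ => h3 i,
    ← eLpNorm_sq_eq_lintegral, Finset.mul_sum, Finset.mul_sum]
  refine add_le_add le_rfl (Finset.sum_le_sum fun i _ => ?_)
  rw [lintegral_const_mul _ (h2 i)]
  exact mul_le_mul' le_rfl
    (lintegral_enorm_mul_le h0.aestronglyMeasurable (h1 i).aestronglyMeasurable)

/-- Ladyzhenskaya's inequality for trigonometric polynomials on the two-dimensional torus. -/
theorem eLpNorm_four_trigSum_le (F : Finset (Fin 2 → ℤ)) (c : (Fin 2 → ℤ) → ℂ) :
    eLpNorm (trigSum F c) 4 volume ^ 2 ≤ eLpNorm (trigSum F c) 2 volume ^ 2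
      + 2 * (eLpNorm (trigSum F c) 2 volume *
        ∑ i : Fin 2, eLpNorm (trigSum F (derivCoef i c)) 2 volume) := by
  refine le_trans ?_ (lintegral_lineDensity_le F c)
  have h4 := eLpNorm_natCast_pow volume (trigSum F c) four_ne_zero
  have h := lintegral_enorm_pow_four_le F c
  rw [← h4, Nat.cast_ofNat, show 4 = 2 * 2 from rfl, pow_mul] at h
  exact (ENNReal.pow_le_pow_left_iff two_ne_zero).1 h

/-- Ladyzhenskaya's inequality for limits of trigonometric polynomials with bounded gradient. -/
theorem eLpNorm_four_le_of_tendsto {f : Torus2 → ℝ} (hf : AEStronglyMeasurable f volume)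
    {F : ℕ → Finset (Fin 2 → ℤ)} {c : (Fin 2 → ℤ) → ℂ} {D : ℝ≥0∞} (hD' : D ≠ ⊤)
    (hlim : Tendsto (fun n => eLpNorm (fun x => f x - trigSum (F n) c x) 2 volume) atTop (𝓝 0))
    (hD : ∀ n, ∑ i : Fin 2, eLpNorm (trigSum (F n) (derivCoef i c)) 2 volume ≤ D) :
    eLpNorm f 4 volume ^ 2 ≤ eLpNorm f 2 volume ^ 2 + 2 * (eLpNorm f 2 volume * D) := by
  have hmeas : ∀ n, AEStronglyMeasurable (trigSum (F n) c) volume := fun n =>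
    (continuous_trigSum (F n) c).aestronglyMeasurable
  have hsymm : ∀ n, eLpNorm (trigSum (F n) c - f) 2 volume
      = eLpNorm (fun x => f x - trigSum (F n) c x) 2 volume := fun n => by
    rw [← eLpNorm_neg]
    congr 1
    funext x
    simp
  have htm : TendstoInMeasure volume (fun n => trigSum (F n) c) atTop f :=
    tendstoInMeasure_of_tendsto_eLpNorm two_ne_zero hmeas hf (hlim.congr fun n => (hsymm n).symm)
  obtain ⟨ns, hns, hae⟩ := htm.exists_seq_tendsto_ae
  set e : ℕ → ℝ≥0∞ := fun n => eLpNorm f 2 volume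
    + eLpNorm (fun x => f x - trigSum (F n) c x) 2 volume with he
  have hle : ∀ n, eLpNorm (trigSum (F n) c) 2 volume ≤ e n := fun n => by
    simp only [he]
    rw [← hsymm]
    calc eLpNorm (trigSum (F n) c) 2 volume
        = eLpNorm (f + (trigSum (F n) c - f)) 2 volume := by rw [add_sub_cancel]
      _ ≤ _ := eLpNorm_add_le hf ((hmeas n).sub hf) one_le_two
  have helim : Tendsto (fun n => e (ns n)) atTop (𝓝 (eLpNorm f 2 volume)) := by
    simpa using ((hlim.comp hns.tendsto_atTop).const_add (eLpNorm f 2 volume))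
  have hbound : ∀ n, eLpNorm (trigSum (F n) c) 4 volume
      ≤ (e n ^ 2 + 2 * (e n * D)) ^ (2 : ℝ)⁻¹ := fun n => by
    rw [ENNReal.le_rpow_inv_iff two_pos, ENNReal.rpow_ofNat]
    refine (eLpNorm_four_trigSum_le (F n) c).trans ?_
    gcongr
    exacts [hle n, hle n, hD n]
  -- Fatou along an almost everywhere convergent subsequence; the bounds on the right converge
  -- because `D` is finite.
  have hlow := Lp.eLpNorm_lim_le_liminf_eLpNorm (p := 4) (fun n => hmeas (ns n)) f hae
  have hY : Tendsto (fun n => (e (ns n) ^ 2 + 2 * (e (ns n) * D)) ^ (2 : ℝ)⁻¹) atTop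
      (𝓝 ((eLpNorm f 2 volume ^ 2 + 2 * (eLpNorm f 2 volume * D)) ^ (2 : ℝ)⁻¹)) :=
    (ENNReal.continuous_rpow_const.tendsto _).comp
      (((ENNReal.continuous_pow 2).tendsto _ |>.comp helim).add
        (ENNReal.Tendsto.const_mul (ENNReal.Tendsto.mul_const helim (Or.inr hD'))
          (Or.inr ENNReal.ofNat_ne_top)))
  have h2 := hlow.trans (liminf_le_liminf (Eventually.of_forall fun n => hbound (ns n)))
  rw [hY.liminf_eq, ENNReal.le_rpow_inv_iff two_pos, ENNReal.rpow_ofNat] at h2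
  exact h2

/-! ### Weak derivatives on the Fourier side. -/

/-- `g` is the weak partial derivative `∂ᵢ f` of the scalar function `f`, tested with
trigonometric monomials. -/
def IsWeakPartial (i : Fin 2) (f g : Torus2 → ℝ) : Prop :=
  ∀ (k : Fin 2 → ℤ) (z : ℂ), ∫ x, torusPartial i (trig k z) x * f x = -∫ x, trig k z x * g x

theorem memLp_coord {α : Type*} [MeasurableSpace α] {μ : Measure α} {p : ℝ≥0∞} {v : α → Plane}
    (hv : MemLp v p μ) (j : Fin 2) : MemLp (fun x => v x j) p μ :=
  (EuclideanSpace.proj (𝕜 := ℝ) j).comp_memLp' hv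

theorem derivCoef_coef {i : Fin 2} {f g : Torus2 → ℝ} (hf : Integrable f volume)
    (h : IsWeakPartial i f g) : derivCoef i (coef f) = coef g := by
  funext k
  have key : ∀ z : ℂ, ∫ x, g x * trig k z x
      = -(2 * Real.pi * k i * ((Complex.I * z).re * (coef f k).re
        + (Complex.I * z).im * (coef f k).im)) := fun z => by
    have h1 := h k z
    rw [torusPartial_trig] at h1
    simp only [mul_comm _ (f _), mul_comm _ (g _)] at h1
    rw [integral_mul_trig hf] at h1
    rw [← neg_neg (∫ x, g x * trig k z x), ← h1, Complex.re_ofReal_mul, Complex.im_ofReal_mul]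
    ring
  apply Complex.ext
  · have := key 1
    simp only [derivCoef, Complex.re_ofReal_mul, coef] at this ⊢
    rw [this]
    simp
  · have := key Complex.I
    simp only [derivCoef, Complex.im_ofReal_mul, coef] at this ⊢
    rw [this]
    simp

theorem IsWeakGradient.isWeakPartial {v : Torus2 → Plane} {g : Torus2 → Fin 2 → Plane}
    (h : IsWeakGradient v g) (hv : Integrable v volume)
    (hg : ∀ i, Integrable (fun x => g x i) volume) (i j : Fin 2) :
    IsWeakPartial i (fun x => v x j) (fun x => g x i j) := by
  intro k z
  have hb : ∀ {φ : Torus2 → ℝ} {w : Torus2 → Plane}, Continuous φ → Integrable w volume →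
      (∫ x, φ x • w x) j = ∫ x, φ x * w x j := by
    intro φ w hφ hw
    obtain ⟨C, hC⟩ := (isCompact_range hφ).isBounded.exists_norm_le
    have hi : Integrable (fun x => φ x • w x) volume :=
      hw.bdd_smul C hφ.aestronglyMeasurable (ae_of_all _ fun x => hC _ ⟨x, rfl⟩)
    exact ((EuclideanSpace.proj (𝕜 := ℝ) j).integral_comp_comm hi).symm
  have := congrArg (fun p : Plane => p j) (h i (trig k z) (torusSmooth_trig k z))
  rw [torusPartial_trig] at this ⊢
  simp only [PiLp.neg_apply] at this
  rwa [hb (continuous_trig _ _) hv, hb (continuous_trig _ _) (hg i)] at this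

theorem trigSum_derivCoef_coef {i : Fin 2} {f g : Torus2 → ℝ} (hf : Integrable f volume)
    (h : IsWeakPartial i f g) (F : Finset (Fin 2 → ℤ)) :
    trigSum F (derivCoef i (coef f)) = trunc F g := by
  rw [derivCoef_coef hf h, trunc]

/-- Ladyzhenskaya's inequality for `f ∈ H¹` with weak gradient `g`, and for the remainders of its
Fourier series. -/
theorem eLpNorm_four_sub_trunc_le {f : Torus2 → ℝ} {g : Fin 2 → Torus2 → ℝ}
    (hf : MemLp f 2 volume) (hg : ∀ i, MemLp (g i) 2 volume)
    (h : ∀ i, IsWeakPartial i f (g i)) (F : Finset (Fin 2 → ℤ)) :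
    eLpNorm (fun x => f x - trunc F f x) 4 volume ^ 2
      ≤ eLpNorm (fun x => f x - trunc F f x) 2 volume ^ 2
        + 2 * (eLpNorm (fun x => f x - trunc F f x) 2 volume *
          ∑ i, eLpNorm (g i) 2 volume) := by
  classical
  obtain ⟨G, hG⟩ := exists_seq_tendsto (atTop : Filter (Finset (Fin 2 → ℤ)))
  have hw : AEStronglyMeasurable (fun x => f x - trunc F f x) volume :=
    hf.1.sub (continuous_trigSum F (coef f)).aestronglyMeasurable
  -- Only frequencies outside `F` are kept, so the polynomials converge to the remainder, while
  -- their derivatives are truncations of `g` and stay bounded by `g`.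
  refine eLpNorm_four_le_of_tendsto (F := fun n => G n \ F) (c := coef f)
    hw ?_ ?_ fun n => ?_
  · exact ENNReal.sum_ne_top.2 fun i _ => (hg i).2.ne
  · have hGF : Tendsto (fun n => G n ∪ F) atTop atTop :=
      tendsto_atTop_mono (fun n => Finset.subset_union_left) hG
    refine ((tendsto_eLpNorm_sub_trunc hf).comp hGF).congr fun n => ?_
    simp only [Function.comp_apply]
    congr 1
    funext x
    simp only [trunc, trigSum]
    rw [← Finset.sdiff_union_self_eq_union, Finset.sum_union Finset.sdiff_disjoint]
    ring
  · refine Finset.sum_le_sum fun i _ => ?_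
    rw [trigSum_derivCoef_coef (hf.integrable one_le_two) (h i)]
    exact eLpNorm_trunc_le (hg i) _

theorem eLpNorm_four_le {f : Torus2 → ℝ} {g : Fin 2 → Torus2 → ℝ}
    (hf : MemLp f 2 volume) (hg : ∀ i, MemLp (g i) 2 volume)
    (h : ∀ i, IsWeakPartial i f (g i)) :
    eLpNorm f 4 volume ^ 2 ≤ eLpNorm f 2 volume ^ 2
        + 2 * (eLpNorm f 2 volume * ∑ i, eLpNorm (g i) 2 volume) := by
  simpa [trunc, trigSum] using eLpNorm_four_sub_trunc_le hf hg h ∅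

/-! ### The transport term and its cancellation. -/

/-- The transport term `∫ v ⊗ v : ∇P v`, where `P` is the Fourier truncation to `F`. -/
noncomputable def transport (F : Finset (Fin 2 → ℤ)) (v : Torus2 → Plane) : ℝ :=
  ∫ x, ∑ i, ∑ j, v x i * v x j * trigSum F (derivCoef i (coef fun y => v y j)) x

theorem torusSmooth_trigSum_sq (F : Finset (Fin 2 → ℤ)) (c : (Fin 2 → ℤ) → ℂ) :
    TorusSmooth fun x => trigSum F c x ^ 2 :=
  (torusSmooth_trigSum F c).pow 2

theorem torusPartial_trigSum_sq (F : Finset (Fin 2 → ℤ)) (c : (Fin 2 → ℤ) → ℂ) (i : Fin 2)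
    (x : Torus2) : torusPartial i (fun x => trigSum F c x ^ 2) x
      = 2 * (trigSum F c x * trigSum F (derivCoef i c) x) := by
  have h := ((hasDerivAt_trigSum F c i x 0).pow 2).deriv
  simp only [AddCircle.coe_zero, Pi.single_zero, add_zero] at h
  refine Eq.trans h ?_
  ring

theorem exists_bound_trigSum (F : Finset (Fin 2 → ℤ)) (c : (Fin 2 → ℤ) → ℂ) :
    ∃ C, ∀ x, ‖trigSum F c x‖ ≤ C := by
  obtain ⟨C, hC⟩ := (isCompact_range (continuous_trigSum F c)).isBounded.exists_norm_le
  exact ⟨C, fun x => hC _ ⟨x, rfl⟩⟩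

theorem integrable_mul_trigSum {f : Torus2 → ℝ} (hf : Integrable f volume)
    (F : Finset (Fin 2 → ℤ)) (c : (Fin 2 → ℤ) → ℂ) :
    Integrable (fun x => f x * trigSum F c x) volume := by
  obtain ⟨C, hC⟩ := exists_bound_trigSum F c
  exact hf.mul_bdd (continuous_trigSum F c).aestronglyMeasurable (ae_of_all _ hC)

/-- Divergence-free fields transport the truncation only through the remainder. -/
theorem transport_eq {v : Torus2 → Plane} (hv : MemLp v 2 volume) (hdiv : WeakDivFree v)
    (F : Finset (Fin 2 → ℤ)) :
    transport F v = ∫ x, ∑ i, ∑ j, v x i * (v x j - trunc F (fun y => v y j) x)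
      * trigSum F (derivCoef i (coef fun y => v y j)) x := by
  have hvi : ∀ i, Integrable (fun x => v x i) volume := fun i =>
    (memLp_coord hv i).integrable one_le_two
  have hvv : ∀ i j, Integrable (fun x => v x i * v x j) volume := fun i j =>
    (memLp_coord hv i).integrable_mul (memLp_coord hv j)
  -- The field `Pv_j` is smooth and `2 Pv_j ∂ᵢPv_j = ∂ᵢ(Pv_j)²`, so testing the divergence condition
  -- with `(Pv_j)²` makes this part vanish.
  have hzero : ∀ j, ∫ x, ∑ i, v x i * trunc F (fun y => v y j) x
      * trigSum F (derivCoef i (coef fun y => v y j)) x = 0 := fun j => by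
    have h := hdiv _ (torusSmooth_trigSum_sq F (coef fun y => v y j))
    simp only [torusPartial_trigSum_sq] at h
    have h2 := congrArg (fun r => (1 / 2 : ℝ) * r) h
    simp only [← integral_const_mul, mul_zero] at h2
    refine Eq.trans (integral_congr_ae (ae_of_all _ fun x => ?_)) h2
    simp only [Finset.mul_sum, trunc]
    exact Finset.sum_congr rfl fun i _ => by ring
  have hint : ∀ i j, Integrable (fun x => v x i * trunc F (fun y => v y j) x
      * trigSum F (derivCoef i (coef fun y => v y j)) x) volume := fun i j =>
    integrable_mul_trigSum (integrable_mul_trigSum (hvi i) F _) F _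
  have hint2 : ∀ i j, Integrable (fun x => v x i * v x j
      * trigSum F (derivCoef i (coef fun y => v y j)) x) volume := fun i j =>
    integrable_mul_trigSum (hvv i j) F _
  have hsum : ∫ x, ∑ j, ∑ i, v x i * trunc F (fun y => v y j) x
      * trigSum F (derivCoef i (coef fun y => v y j)) x = 0 := by
    rw [integral_finsetSum _ fun j _ => integrable_finsetSum _ fun i _ => hint i j]
    exact Finset.sum_eq_zero fun j _ => hzero j
  rw [transport, ← sub_zero (∫ x, _), ← hsum, ← integral_sub]
  · refine integral_congr_ae (ae_of_all _ fun x => ?_)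
    simp only [Fin.sum_univ_two]
    ring
  · exact integrable_finsetSum _ fun i _ => integrable_finsetSum _ fun j _ => hint2 i j
  · exact integrable_finsetSum _ fun j _ => integrable_finsetSum _ fun i _ => hint i j

theorem lintegral_enorm_mul_mul_le {α : Type*} [MeasurableSpace α] {μ : Measure α}
    {f g h : α → ℝ} (hf : AEStronglyMeasurable f μ) (hg : AEStronglyMeasurable g μ)
    (hh : AEStronglyMeasurable h μ) :
    ∫⁻ x, ‖f x * g x * h x‖ₑ ∂μ ≤ eLpNorm f 4 μ * eLpNorm g 4 μ * eLpNorm h 2 μ := by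
  have : ENNReal.HolderTriple 4 4 2 := ⟨by
    rw [← two_mul, show (4 : ℝ≥0∞) = 2 * 2 by norm_num,
      ENNReal.mul_inv (Or.inl two_ne_zero) (Or.inl ENNReal.ofNat_ne_top), ← mul_assoc,
      ENNReal.mul_inv_cancel two_ne_zero ENNReal.ofNat_ne_top, one_mul]⟩
  have h1 := eLpNorm_smul_le_mul_eLpNorm (p := 4) (q := 4) (r := 2) hg hf
  rw [show f • g = fun x => f x * g x from rfl] at h1
  have h2 : ∫⁻ x, ‖f x * g x‖ₑ * ‖h x‖ₑ ∂μ ≤ eLpNorm (fun x => f x * g x) 2 μ * eLpNorm h 2 μ :=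
    lintegral_enorm_mul_le (hf.mul hg) hh
  simp only [fun x => enorm_mul (f x * g x) (h x)]
  exact h2.trans (mul_le_mul' h1 le_rfl)

theorem lintegral_enorm_sum_le {α ι : Type*} [MeasurableSpace α] {μ : Measure α}
    {s : Finset ι} {f : ι → α → ℝ} (hf : ∀ i ∈ s, AEStronglyMeasurable (f i) μ) :
    ∫⁻ x, ‖∑ i ∈ s, f i x‖ₑ ∂μ ≤ ∑ i ∈ s, ∫⁻ x, ‖f i x‖ₑ ∂μ := by
  rw [← lintegral_finsetSum' _ fun i hi => (hf i hi).enorm]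
  exact lintegral_mono fun x => enorm_sum_le _ _

/-- Truncation commutes with the weak derivative and is a contraction on `L²`, so the gradient
factor is controlled uniformly in `F`; all smallness comes from the remainder in `L⁴`. -/
theorem enorm_transport_le {v : Torus2 → Plane} {g : Torus2 → Fin 2 → Plane}
    (hv : MemLp v 2 volume) (hdiv : WeakDivFree v) (hg : ∀ i, MemLp (fun x => g x i) 2 volume)
    (h : IsWeakGradient v g) (F : Finset (Fin 2 → ℤ)) :
    ‖transport F v‖ₑ ≤ ∑ i, ∑ j, eLpNorm (fun x => v x i) 4 volume
      * eLpNorm (fun x => v x j - trunc F (fun y => v y j) x) 4 volume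
      * eLpNorm (fun x => g x i j) 2 volume := by
  have hvi := fun i => memLp_coord hv i
  have hw : ∀ j, AEStronglyMeasurable (fun x => v x j - trunc F (fun y => v y j) x) volume :=
    fun j => (hvi j).1.sub (continuous_trigSum F _).aestronglyMeasurable
  have hwp : ∀ i j, IsWeakPartial i (fun x => v x j) (fun x => g x i j) :=
    h.isWeakPartial (hv.integrable one_le_two) fun i => (hg i).integrable one_le_two
  have hd : ∀ i j, trigSum F (derivCoef i (coef fun y => v y j)) = trunc F fun x => g x i j :=
    fun i j => trigSum_derivCoef_coef ((hvi j).integrable one_le_two) (hwp i j) F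
  have hc : ∀ i j, AEStronglyMeasurable (trunc F fun x => g x i j) volume := fun i j =>
    (continuous_trigSum F _).aestronglyMeasurable
  have hmeas : ∀ i j, AEStronglyMeasurable (fun x => v x i *
      (v x j - trunc F (fun y => v y j) x) * trunc F (fun x => g x i j) x) volume := fun i j =>
    ((hvi i).1.mul (hw j)).mul (hc i j)
  rw [transport_eq hv hdiv]
  simp only [hd]
  refine (enorm_integral_le_lintegral_enorm _).trans ?_
  refine (lintegral_enorm_sum_le fun i _ =>
    Finset.aestronglyMeasurable_fun_sum _ fun j _ => hmeas i j).trans ?_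
  refine Finset.sum_le_sum fun i _ => (lintegral_enorm_sum_le fun j _ => hmeas i j).trans ?_
  refine Finset.sum_le_sum fun j _ => ?_
  refine (lintegral_enorm_mul_mul_le (hvi i).1 (hw j) (hc i j)).trans ?_
  exact mul_le_mul' le_rfl (eLpNorm_trunc_le (memLp_coord (hg i) j) F)

/-- The sum of the `L²` norms of the components of a gradient. -/
noncomputable def gradNorm (g : Torus2 → Fin 2 → Plane) : ℝ≥0∞ :=
  ∑ i : Fin 2, ∑ j : Fin 2, eLpNorm (fun x => g x i j) 2 volume

theorem eLpNorm_coord_le {α : Type*} [MeasurableSpace α] {μ : Measure α} (p : ℝ≥0∞)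
    (v : α → Plane) (j : Fin 2) : eLpNorm (fun x => v x j) p μ ≤ eLpNorm v p μ :=
  eLpNorm_mono fun x => PiLp.norm_apply_le (v x) j

theorem ENNReal_mul_le_add_sq (x y : ℝ≥0∞) : x * y ≤ x ^ 2 + y ^ 2 := by
  rcases le_total x y with h | h
  · exact (mul_le_mul' h le_rfl).trans (by rw [← sq]; exact le_add_self)
  · exact (mul_le_mul' le_rfl h).trans (by rw [← sq]; exact le_self_add)

section

variable {v : Torus2 → Plane} {g : Torus2 → Fin 2 → Plane}

theorem sum_eLpNorm_le_gradNorm (j : Fin 2) :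
    ∑ i, eLpNorm (fun x => g x i j) 2 volume ≤ gradNorm g :=
  Finset.sum_le_sum fun i _ => Finset.single_le_sum_of_canonicallyOrdered
    (f := fun j => eLpNorm (fun x => g x i j) 2 volume) (Finset.mem_univ j)

theorem gradNorm_ne_top (hg : ∀ i, MemLp (fun x => g x i) 2 volume) : gradNorm g ≠ ⊤ :=
  ENNReal.sum_ne_top.2 fun i _ => ENNReal.sum_ne_top.2 fun j _ => (memLp_coord (hg i) j).2.ne

theorem eLpNorm_four_coord_le (hv : MemLp v 2 volume)
    (hg : ∀ i, MemLp (fun x => g x i) 2 volume) (h : IsWeakGradient v g) (j : Fin 2) :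
    eLpNorm (fun x => v x j) 4 volume ^ 2
      ≤ eLpNorm v 2 volume ^ 2 + 2 * (eLpNorm v 2 volume * gradNorm g) := by
  refine (eLpNorm_four_le (memLp_coord hv j) (fun i => memLp_coord (hg i) j)
    fun i => h.isWeakPartial (hv.integrable one_le_two)
      (fun i => (hg i).integrable one_le_two) i j).trans ?_
  gcongr
  exacts [eLpNorm_coord_le 2 v j, eLpNorm_coord_le 2 v j, sum_eLpNorm_le_gradNorm j]

theorem eLpNorm_four_coord_sub_le (hv : MemLp v 2 volume)
    (hg : ∀ i, MemLp (fun x => g x i) 2 volume) (h : IsWeakGradient v g)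
    (F : Finset (Fin 2 → ℤ)) (j : Fin 2) :
    eLpNorm (fun x => v x j - trunc F (fun y => v y j) x) 4 volume ^ 2
      ≤ eLpNorm (fun x => v x j - trunc F (fun y => v y j) x) 2 volume ^ 2
        + 2 * (eLpNorm (fun x => v x j - trunc F (fun y => v y j) x) 2 volume * gradNorm g) := by
  refine (eLpNorm_four_sub_trunc_le (memLp_coord hv j) (fun i => memLp_coord (hg i) j)
    (fun i => h.isWeakPartial (hv.integrable one_le_two)
      (fun i => (hg i).integrable one_le_two) i j) F).trans ?_
  gcongr
  exact sum_eLpNorm_le_gradNorm j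

theorem eLpNorm_coord_sub_trunc_le (hv : MemLp v 2 volume) (F : Finset (Fin 2 → ℤ)) (j : Fin 2) :
    eLpNorm (fun x => v x j - trunc F (fun y => v y j) x) 2 volume
      ≤ 2 * eLpNorm v 2 volume := by
  have h1 : eLpNorm ((fun x => v x j) - trunc F fun y => v y j) 2 volume
      ≤ eLpNorm (fun x => v x j) 2 volume + eLpNorm (trunc F fun y => v y j) 2 volume :=
    eLpNorm_sub_le (memLp_coord hv j).1 (continuous_trigSum F _).aestronglyMeasurable one_le_two
  refine h1.trans ?_
  rw [two_mul]
  exact add_le_add (eLpNorm_coord_le 2 v j)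
    ((eLpNorm_trunc_le (memLp_coord hv j) F).trans (eLpNorm_coord_le 2 v j))

/-- A bound for the transport term which is uniform in the truncation. -/
theorem enorm_transport_le_gradNorm (hv : MemLp v 2 volume) (hdiv : WeakDivFree v)
    (hg : ∀ i, MemLp (fun x => g x i) 2 volume) (h : IsWeakGradient v g)
    (F : Finset (Fin 2 → ℤ)) :
    ‖transport F v‖ₑ ≤ 5 * (eLpNorm v 2 volume ^ 2
      + 2 * (eLpNorm v 2 volume * gradNorm g)) * gradNorm g := by
  refine (enorm_transport_le hv hdiv hg h F).trans ?_
  have hsum : ∀ {S : ℝ≥0∞} {X : Fin 2 → Fin 2 → ℝ≥0∞}, (∀ i j, X i j ≤ S) →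
      ∑ i, ∑ j, X i j * eLpNorm (fun x => g x i j) 2 volume ≤ S * gradNorm g := by
    intro S X hX
    simp only [gradNorm, Finset.mul_sum]
    exact Finset.sum_le_sum fun i _ => Finset.sum_le_sum fun j _ => mul_le_mul' (hX i j) le_rfl
  refine hsum fun i j => ?_
  refine (ENNReal_mul_le_add_sq _ _).trans ?_
  have h1 := eLpNorm_four_coord_le hv hg h i
  have h2 := eLpNorm_four_coord_sub_le hv hg h F j
  have h3 := eLpNorm_coord_sub_trunc_le hv F j
  calc _ ≤ _ := add_le_add h1 h2
    _ ≤ (eLpNorm v 2 volume ^ 2 + 2 * (eLpNorm v 2 volume * gradNorm g))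
        + ((2 * eLpNorm v 2 volume) ^ 2
          + 2 * ((2 * eLpNorm v 2 volume) * gradNorm g)) := by gcongr
    -- With `N` the norm of `v` and `G` that of the gradient, the previous line is `5N² + 6NG`;
    -- adding `4NG` makes it `5(N² + 2NG)`.
    _ ≤ (eLpNorm v 2 volume ^ 2 + 2 * (eLpNorm v 2 volume * gradNorm g))
        + ((2 * eLpNorm v 2 volume) ^ 2
          + 2 * ((2 * eLpNorm v 2 volume) * gradNorm g))
          + 4 * (eLpNorm v 2 volume * gradNorm g) := le_self_add
    _ = _ := by ring

/-- By Ladyzhenskaya's inequality the remainder tends to zero in `L⁴`: its `L²` norm does so and the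
gradient factor is a fixed finite number. -/
theorem tendsto_transport (hv : MemLp v 2 volume) (hdiv : WeakDivFree v)
    (hg : ∀ i, MemLp (fun x => g x i) 2 volume) (h : IsWeakGradient v g) :
    Tendsto (fun F => ‖transport F v‖ₑ) atTop (𝓝 0) := by
  have hv4 : ∀ i, eLpNorm (fun x => v x i) 4 volume ≠ ⊤ := fun i htop => by
    have := eLpNorm_four_coord_le hv hg h i
    rw [htop, ENNReal.top_pow two_ne_zero, top_le_iff] at this
    exact (ENNReal.add_ne_top.2 ⟨ENNReal.pow_ne_top hv.2.ne, ENNReal.mul_ne_top (by simp)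
      (ENNReal.mul_ne_top hv.2.ne (gradNorm_ne_top hg))⟩) this
  have hw : ∀ j, Tendsto (fun F => eLpNorm (fun x => v x j - trunc F (fun y => v y j) x) 4 volume)
      atTop (𝓝 0) := fun j => by
    have hq := tendsto_eLpNorm_sub_trunc (memLp_coord hv j)
    have hY := (ENNReal.continuous_rpow_const (y := (2 : ℝ)⁻¹).tendsto _).comp
      (((ENNReal.continuous_pow 2).tendsto _ |>.comp hq).add
        (ENNReal.Tendsto.const_mul (ENNReal.Tendsto.mul_const hq (Or.inr (gradNorm_ne_top hg)))
          (Or.inr (ENNReal.ofNat_ne_top (n := 2)))))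
    simp only [zero_mul, mul_zero, add_zero, ne_eq, OfNat.ofNat_ne_zero, not_false_eq_true,
      zero_pow] at hY
    rw [ENNReal.zero_rpow_of_pos (by norm_num)] at hY
    refine tendsto_of_tendsto_of_tendsto_of_le_of_le tendsto_const_nhds hY (fun _ => zero_le)
      fun F => ?_
    simp only [Function.comp_apply]
    rw [ENNReal.le_rpow_inv_iff two_pos, ENNReal.rpow_ofNat]
    exact eLpNorm_four_coord_sub_le hv hg h F j
  refine tendsto_of_tendsto_of_tendsto_of_le_of_le tendsto_const_nhds ?_ (fun _ => zero_le)
    fun F => enorm_transport_le hv hdiv hg h F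
  rw [show (0 : ℝ≥0∞) = ∑ i : Fin 2, ∑ j : Fin 2, 0 by simp]
  refine tendsto_finsetSum _ fun i _ => tendsto_finsetSum _ fun j _ => ?_
  have := ENNReal.Tendsto.mul_const (b := eLpNorm (fun x => g x i j) 2 volume)
    (ENNReal.Tendsto.const_mul (hw j) (Or.inr (hv4 i)))
    (Or.inr (memLp_coord (hg i) j).2.ne)
  simpa using this

end

/-! ### Weak time derivatives and absolutely continuous primitives. -/

theorem intervalIntegrable_of_timeMeasure {T : ℝ} {h : ℝ → ℝ} (hT : 0 ≤ T)
    (hh : Integrable h (timeMeasure T)) : IntervalIntegrable h volume 0 T := by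
  rw [intervalIntegrable_iff_integrableOn_Icc_of_le hT]
  exact hh

theorem integral_timeMeasure {T : ℝ} (hT : 0 ≤ T) (h : ℝ → ℝ) :
    ∫ t, h t ∂timeMeasure T = ∫ t in (0 : ℝ)..T, h t := by
  rw [timeMeasure, integral_Icc_eq_integral_Ioc, intervalIntegral.integral_of_le hT]

theorem absolutelyContinuous_primitive {T y₀ : ℝ} {h : ℝ → ℝ}
    (hh : IntervalIntegrable h volume 0 T) :
    AbsolutelyContinuousOnInterval (fun t => y₀ + ∫ s in (0 : ℝ)..t, h s) 0 T := by
  have h0 : AbsolutelyContinuousOnInterval (fun _ : ℝ => y₀) 0 T :=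
    contDiffOn_const.absolutelyContinuousOnInterval
  exact h0.add (hh.absolutelyContinuousOnInterval_intervalIntegral (by simp))

theorem ae_deriv_primitive {T y₀ : ℝ} {h : ℝ → ℝ} (hh : IntervalIntegrable h volume 0 T) :
    ∀ᵐ t, t ∈ Set.uIcc 0 T → deriv (fun t => y₀ + ∫ s in (0 : ℝ)..t, h s) t = h t := by
  filter_upwards [hh.ae_hasDerivAt_integral] with t ht hmem
  exact ((ht hmem 0 (by simp)).const_add y₀).deriv

/-- Integrating from `T` makes the primitive vanish near `T` and beyond. It need not vanish at 0,
which is how the initial value enters the weak formulation. -/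
theorem exists_smooth_primitive {T : ℝ} {g : ℝ → ℝ} (hg : ContDiff ℝ ∞ g)
    (hsupp : tsupport g ⊆ Set.Ioo 0 T) :
    ∃ χ : ℝ → ℝ, ContDiff ℝ ∞ χ ∧ deriv χ = g ∧ ∃ S < T, ∀ t ≥ S, χ t = 0 := by
  have hd : ∀ t, HasDerivAt (fun t => ∫ s in T..t, g s) (g t) t := fun t =>
    intervalIntegral.integral_hasDerivAt_right (hg.continuous.intervalIntegrable _ _)
      (hg.continuous.stronglyMeasurableAtFilter _ _) hg.continuous.continuousAt
  have hderiv : deriv (fun t => ∫ s in T..t, g s) = g := funext fun t => (hd t).deriv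
  refine ⟨fun t => ∫ s in T..t, g s, ?_, hderiv, ?_⟩
  · rw [contDiff_infty_iff_deriv, hderiv]
    exact ⟨fun t => (hd t).differentiableAt, hg⟩
  · have hT : T ∉ tsupport g := fun h => lt_irrefl T (hsupp h).2
    obtain ⟨ε, hε, hball⟩ := Metric.isOpen_iff.1 (isClosed_tsupport g).isOpen_compl T hT
    refine ⟨T - ε / 2, by linarith, fun t ht => ?_⟩
    refine intervalIntegral.integral_zero_ae (ae_of_all _ fun s hs => ?_)
    by_contra hne
    have hs' := subset_tsupport g hne
    have h1 := (hsupp hs').2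
    have h2 : T - ε / 2 ≤ s := by
      rcases Set.mem_uIoc.1 hs with h | h <;> linarith
    exact hball (by rw [Metric.mem_ball, Real.dist_eq, abs_lt]; constructor <;> linarith) hs'

/-- A function whose distributional derivative on `[0,T)`, with initial value `y₀`, is the
integrable function `h`, is almost everywhere a primitive of `h`. -/
theorem ae_eq_primitive {T y₀ : ℝ} (hT : 0 < T) {y h : ℝ → ℝ}
    (hy : Integrable y (timeMeasure T)) (hh : Integrable h (timeMeasure T))
    (hweak : ∀ χ : ℝ → ℝ, ContDiff ℝ ∞ χ → (∃ S < T, ∀ t ≥ S, χ t = 0) →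
      ∫ t, (deriv χ t * y t + χ t * h t) ∂timeMeasure T = -(χ 0 * y₀)) :
    ∀ᵐ t ∂timeMeasure T, y t = y₀ + ∫ s in (0 : ℝ)..t, h s := by
  have hyI := intervalIntegrable_of_timeMeasure hT.le hy
  have hhI := intervalIntegrable_of_timeMeasure hT.le hh
  set Y : ℝ → ℝ := fun t => y₀ + ∫ s in (0 : ℝ)..t, h s with hYdef
  have hYac : AbsolutelyContinuousOnInterval Y 0 T := absolutelyContinuous_primitive hhI
  have hYc : ContinuousOn Y (Set.uIcc 0 T) := hYac.continuousOn
  have hzI : IntervalIntegrable (fun t => y t - Y t) volume 0 T := hyI.sub hYc.intervalIntegrable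
  have hzint : IntegrableOn (fun t => y t - Y t) (Set.Icc 0 T) volume :=
    (intervalIntegrable_iff_integrableOn_Icc_of_le hT.le).1 hzI
  have key : ∀ g : ℝ → ℝ, ContDiff ℝ ∞ g → HasCompactSupport g → tsupport g ⊆ Set.Ioo 0 T →
      ∫ t, g t • (y t - Y t) = 0 := by
    intro g hg _ hsupp
    obtain ⟨χ, hχ, hχd, S, hS, hχS⟩ := exists_smooth_primitive hg hsupp
    have h1 := hweak χ hχ ⟨S, hS, hχS⟩
    rw [integral_timeMeasure hT.le] at h1
    have hχac : AbsolutelyContinuousOnInterval χ 0 T :=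
      (hχ.of_le (by exact_mod_cast le_top)).contDiffOn.absolutelyContinuousOnInterval
    -- The candidate `Y` satisfies the same weak identity with the same boundary term, so `y - Y` is
    -- orthogonal to every `g`, with no undetermined constant.
    have h2 := hχac.integral_deriv_mul_eq_sub hYac
    have h3 : ∫ x in (0 : ℝ)..T, deriv χ x * Y x + χ x * deriv Y x
        = ∫ x in (0 : ℝ)..T, deriv χ x * Y x + χ x * h x := by
      refine intervalIntegral.integral_congr_ae ?_
      filter_upwards [ae_deriv_primitive (y₀ := y₀) hhI] with t ht hmem
      rw [ht (Set.uIoc_subset_uIcc hmem)]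
    rw [h3, hχS T hS.le, show Y 0 = y₀ by simp [hYdef]] at h2
    rw [hχd] at h1 h2
    have hχh : IntervalIntegrable (fun t => χ t * h t) volume 0 T :=
      hhI.continuousOn_mul hχ.continuous.continuousOn
    have h4 : ∫ x in (0 : ℝ)..T, g x * (y x - Y x) = 0 := by
      have : ∫ x in (0 : ℝ)..T, g x * (y x - Y x)
          = (∫ x in (0 : ℝ)..T, g x * y x + χ x * h x)
            - ∫ x in (0 : ℝ)..T, g x * Y x + χ x * h x := by
        rw [← intervalIntegral.integral_sub]
        · exact intervalIntegral.integral_congr fun t _ => by ring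
        · exact (hyI.continuousOn_mul hg.continuous.continuousOn).add hχh
        · exact (hYc.intervalIntegrable.continuousOn_mul hg.continuous.continuousOn).add hχh
      rw [this, h1, h2]
      ring
    rw [intervalIntegral.integral_of_le hT.le] at h4
    rw [← h4, eq_comm]
    refine setIntegral_eq_integral_of_forall_compl_eq_zero fun t ht => ?_
    have : g t = 0 := by
      by_contra hne
      exact ht (Set.Ioo_subset_Ioc_self (hsupp (subset_tsupport g hne)))
    simp [this]
  have hae := isOpen_Ioo.ae_eq_zero_of_integral_contDiff_smul_eq_zero
    ((hzint.mono_set Set.Ioo_subset_Icc_self).locallyIntegrableOn) key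
  rw [timeMeasure, ← restrict_Ioo_eq_restrict_Icc, ae_restrict_iff' measurableSet_Ioo]
  filter_upwards [hae] with t ht hmem
  exact sub_eq_zero.1 (ht hmem)

/-- A product of integrable functions need not be integrable; here one factor agrees almost
everywhere with a continuous function on a compact interval. -/
theorem integrable_mul_of_ae_eq_primitive {T y₀ : ℝ} (hT : 0 ≤ T) {y h f : ℝ → ℝ}
    (hh : Integrable h (timeMeasure T))
    (hy : ∀ᵐ t ∂timeMeasure T, y t = y₀ + ∫ s in (0 : ℝ)..t, h s)
    (hf : Integrable f (timeMeasure T)) : Integrable (fun t => y t * f t) (timeMeasure T) := by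
  have hhI := intervalIntegrable_of_timeMeasure hT hh
  have h1 := (intervalIntegrable_of_timeMeasure hT hf).continuousOn_mul
    (absolutelyContinuous_primitive (y₀ := y₀) hhI).continuousOn
  rw [intervalIntegrable_iff_integrableOn_Icc_of_le hT] at h1
  refine Integrable.congr h1 ?_
  filter_upwards [hy] with t ht
  rw [ht]

theorem ae_sq_eq_primitive {T y₀ : ℝ} (hT : 0 < T) {y h : ℝ → ℝ}
    (hh : Integrable h (timeMeasure T))
    (hy : ∀ᵐ t ∂timeMeasure T, y t = y₀ + ∫ s in (0 : ℝ)..t, h s) :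
    ∀ᵐ t ∂timeMeasure T, y t ^ 2 = y₀ ^ 2 + ∫ s in (0 : ℝ)..t, 2 * (y s * h s) := by
  have hmem : ∀ᵐ t ∂timeMeasure T, t ∈ Set.Icc 0 T := ae_restrict_mem measurableSet_Icc
  have hhI := intervalIntegrable_of_timeMeasure hT.le hh
  filter_upwards [hy, hmem] with t ht htmem
  have hsub : Set.uIcc 0 t ⊆ Set.Icc 0 T := by
    rw [Set.uIcc_of_le htmem.1]
    exact Set.Icc_subset_Icc_right htmem.2
  have hhI' : IntervalIntegrable h volume 0 t :=
    hhI.mono_set (by rw [Set.uIcc_of_le hT.le]; exact hsub)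
  have hYac := absolutelyContinuous_primitive (y₀ := y₀) hhI'
  -- Integration by parts of the primitive against itself, which is the chain rule for its square.
  have h2 := hYac.integral_deriv_mul_eq_sub hYac
  have h3 : ∫ x in (0 : ℝ)..t, deriv (fun t => y₀ + ∫ s in (0 : ℝ)..t, h s) x
        * (y₀ + ∫ s in (0 : ℝ)..x, h s) + (y₀ + ∫ s in (0 : ℝ)..x, h s)
        * deriv (fun t => y₀ + ∫ s in (0 : ℝ)..t, h s) x
      = ∫ s in (0 : ℝ)..t, 2 * (y s * h s) := by
    refine intervalIntegral.integral_congr_ae ?_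
    have hy' := (ae_restrict_iff' measurableSet_Icc).1 hy
    filter_upwards [ae_deriv_primitive (y₀ := y₀) hhI', hy'] with s hs hys hmem
    have hmem' := Set.uIoc_subset_uIcc hmem
    rw [hs hmem', ← hys (hsub hmem')]
    ring
  rw [h3] at h2
  rw [h2, ← ht]
  simp
  ring

/-! ### Single-mode solenoidal test fields and the modes of a field. -/

theorem hasDerivAt_trig_smul {k : Fin 2 → ℤ} {z : ℂ} (c : ℝ) (d : Plane) (i : Fin 2)
    (x : Torus2) :
    HasDerivAt (fun s : ℝ => c • trig k z (x + Pi.single i (s : UnitAddCircle)) • d)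
      (c • trig k ((2 * Real.pi * k i : ℝ) * (Complex.I * z)) x • d) 0 := by
  have := hasDerivAt_trig k z i x 0
  simp only [AddCircle.coe_zero, Pi.single_zero, add_zero] at this
  exact (this.smul_const d).const_smul c

theorem torusPartial_trig_smul (k : Fin 2 → ℤ) (z : ℂ) (c : ℝ) (d : Plane) (i : Fin 2) :
    torusPartial i (fun x => c • trig k z x • d)
      = fun x => c • trig k ((2 * Real.pi * k i : ℝ) * (Complex.I * z)) x • d :=
  funext fun x => (hasDerivAt_trig_smul c d i x).deriv

theorem torusLaplacian_trig_smul (k : Fin 2 → ℤ) (z : ℂ) (c : ℝ) (d : Plane) (x : Torus2) :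
    torusLaplacian (fun x => c • trig k z x • d) x
      = c • (-(4 * Real.pi ^ 2 * ∑ i, (k i : ℝ) ^ 2) * trig k z x) • d := by
  have h := torusLaplacian_trig k z x
  simp only [torusLaplacian, torusPartial_trig, Fin.sum_univ_two] at h
  simp only [torusLaplacian, torusPartial_trig_smul, Fin.sum_univ_two, ← smul_add, ← add_smul, h]

theorem isTestField_trig {T : ℝ} {χ : ℝ → ℝ} (hχ : ContDiff ℝ ∞ χ)
    (hsupp : ∃ S < T, ∀ t ≥ S, χ t = 0) {k : Fin 2 → ℤ} (z : ℂ) {d : Plane}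
    (hd : ∑ i, (k i : ℝ) * d i = 0) : IsTestField T fun t x => χ t • trig k z x • d where
  smooth := by
    have h1 : ContDiff ℝ ∞ fun q : ℝ × (Fin 2 → ℝ) => trig k z (toTorus2 q.2) :=
      ContDiff.comp (g := fun y => trig k z (toTorus2 y)) (torusSmooth_trig k z) contDiff_snd
    exact (hχ.comp contDiff_fst).smul (h1.smul contDiff_const)
  support := by
    obtain ⟨S, hS, h⟩ := hsupp
    exact ⟨S, hS, fun t ht x => by rw [h t ht, zero_smul]⟩
  div_free t x := by
    have h : ∀ i, torusPartial i (fun y => (χ t • trig k z y • d) i) x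
        = (k i * d i) * (χ t * (2 * Real.pi * trig k (Complex.I * z) x)) := fun i => by
      have := hasDerivAt_trig k z i x 0
      simp only [AddCircle.coe_zero, Pi.single_zero, add_zero] at this
      have h2 := ((this.mul_const (d i)).const_mul (χ t)).deriv
      refine Eq.trans h2 ?_
      rw [trig_ofReal_mul]
      ring
    simp only [h, ← Finset.sum_mul, hd, zero_mul]

/-- The projection of the `m`-th coordinate vector orthogonally to the frequency `k`. -/
noncomputable def solenoidalDir (k : Fin 2 → ℤ) (m : Fin 2) : Plane :=
  WithLp.toLp 2 fun i => (if i = m then 1 else 0) - k m * k i / ∑ l, (k l : ℝ) ^ 2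

theorem solenoidalDir_apply (k : Fin 2 → ℤ) (m i : Fin 2) :
    solenoidalDir k m i = (if i = m then 1 else 0) - k m * k i / ∑ l, (k l : ℝ) ^ 2 := rfl

/-- At `k = 0` division by zero returns 0, so `solenoidalDir` is the full coordinate vector; this is
the right choice, since constant fields are divergence-free. -/
theorem sum_mul_solenoidalDir (k : Fin 2 → ℤ) (m : Fin 2) :
    ∑ i, (k i : ℝ) * solenoidalDir k m i = 0 := by
  by_cases hk : ∑ l, (k l : ℝ) ^ 2 = 0
  · have : ∀ i, (k i : ℝ) = 0 := fun i => by
      have := (Finset.sum_eq_zero_iff_of_nonneg (fun i _ => sq_nonneg (k i : ℝ))).1 hk i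
        (Finset.mem_univ i)
      exact pow_eq_zero_iff two_ne_zero |>.1 this
    simp [this]
  · simp only [solenoidalDir_apply, mul_sub, Finset.sum_sub_distrib]
    have h2 : ∑ i, (k i : ℝ) * (k m * k i / ∑ l, (k l : ℝ) ^ 2) = k m := by
      rw [show ∑ i, (k i : ℝ) * (k m * k i / ∑ l, (k l : ℝ) ^ 2)
        = k m * ((∑ i, (k i : ℝ) ^ 2) / ∑ l, (k l : ℝ) ^ 2) by
          rw [Finset.sum_div, Finset.mul_sum]
          exact Finset.sum_congr rfl fun i _ => by ring, div_self hk, mul_one]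
    rw [h2]
    simp

theorem inner_solenoidalDir {k : Fin 2 → ℤ} {a : Plane} (ha : ∑ i, (k i : ℝ) * a i = 0)
    (m : Fin 2) : ∑ i, a i * solenoidalDir k m i = a m := by
  have h : ∑ i, a i * (k m * k i / ∑ l, (k l : ℝ) ^ 2)
      = (k m / ∑ l, (k l : ℝ) ^ 2) * ∑ i, (k i : ℝ) * a i := by
    rw [Finset.mul_sum]
    exact Finset.sum_congr rfl fun i _ => by ring
  simp only [solenoidalDir_apply, mul_sub, Finset.sum_sub_distrib, h, ha]
  simp

/-- The projection is symmetric and fixes vectors orthogonal to `k`. Thus testing only in solenoidal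
directions loses nothing for divergence-free fields. -/
theorem sum_smul_solenoidalDir {k : Fin 2 → ℤ} {a : Plane} (ha : ∑ i, (k i : ℝ) * a i = 0)
    (j : Fin 2) : ∑ m, a m * solenoidalDir k m j = a j := by
  rw [← inner_solenoidalDir ha j]
  refine Finset.sum_congr rfl fun m _ => ?_
  simp only [solenoidalDir_apply, eq_comm (a := j), mul_comm (k m : ℝ)]

/-- The real and imaginary trigonometric phases. -/
noncomputable def phase : Fin 2 → ℂ := ![1, Complex.I]

/-- The coefficient of the field `v` with respect to a real trigonometric monomial. -/
noncomputable def mode (v : Torus2 → Plane) (k : Fin 2 → ℤ) (z : ℂ) : Plane :=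
  WithLp.toLp 2 fun m => ∫ x, v x m * trig k z x

theorem mode_apply (v : Torus2 → Plane) (k : Fin 2 → ℤ) (z : ℂ) (m : Fin 2) :
    mode v k z m = ∫ x, v x m * trig k z x := rfl

/-- The flux of momentum in direction `d` through a trigonometric monomial. -/
noncomputable def flux (v : Torus2 → Plane) (k : Fin 2 → ℤ) (z : ℂ) (d : Plane) : ℝ :=
  ∫ x, ∑ i, v x i * inner ℝ (v x) d * trig k ((2 * Real.pi * k i : ℝ) * (Complex.I * z)) x

theorem norm_coef_sq (v : Torus2 → Plane) (k : Fin 2 → ℤ) (m : Fin 2) :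
    ‖coef (fun x => v x m) k‖ ^ 2 = ∑ σ, mode v k (phase σ) m ^ 2 := by
  rw [← Complex.normSq_eq_norm_sq, Complex.normSq_apply]
  simp [Fin.sum_univ_two, mode_apply, phase, coef, sq]

theorem WeakDivFree.mode_orthogonal {v : Torus2 → Plane} (hdiv : WeakDivFree v)
    (hv : Integrable v volume) (k : Fin 2 → ℤ) (z : ℂ) : ∑ i, (k i : ℝ) * mode v k z i = 0 := by
  -- The phase `-I` is chosen so that the gradient of this function is `2πk` times `trig k z`.
  have h := hdiv (trig k (-Complex.I * z)) (torusSmooth_trig k _)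
  simp only [torusPartial_trig, trig_ofReal_mul] at h
  rw [show Complex.I * (-Complex.I * z) = z by
    linear_combination (-z) * Complex.I_sq] at h
  have hi : ∀ i, Integrable (fun x => v x i * (2 * Real.pi * k i * trig k z x)) volume := fun i =>
    ((integrable_mul_trig (memLp_one_iff_integrable.1
      (memLp_coord (memLp_one_iff_integrable.2 hv) i)) k z).const_mul
        (2 * Real.pi * k i)).congr (ae_of_all _ fun x => by ring)
  rw [integral_finsetSum _ fun i _ => hi i] at h
  have h2 : ∀ i, ∫ x, v x i * (2 * Real.pi * k i * trig k z x)
      = 2 * Real.pi * ((k i : ℝ) * mode v k z i) := fun i => by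
    rw [mode_apply, ← integral_const_mul, ← integral_const_mul]
    exact integral_congr_ae (ae_of_all _ fun x => by ring)
  simp only [h2, ← Finset.mul_sum] at h
  exact (mul_eq_zero.1 h).resolve_left (by positivity)

theorem inner_eq_sum (a d : Plane) : inner ℝ a d = ∑ j, a j * d j := by
  simp [PiLp.inner_apply, mul_comm]

section

variable {v : Torus2 → Plane}

theorem integrable_flux_term (hv : MemLp v 2 volume) (k : Fin 2 → ℤ) (z : ℂ) (d : Plane)
    (i : Fin 2) : Integrable (fun x => v x i * inner ℝ (v x) d * trig k z x) volume :=
  integrable_mul_trig ((memLp_coord hv i).integrable_mul (hv.inner_const d)) k z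

/-- The modes are orthogonal to their frequencies, so weighting the projected directions by them
reassembles the gradient of the truncation. -/
theorem sum_mode_mul_flux (hv : MemLp v 2 volume) (hdiv : WeakDivFree v)
    (F : Finset (Fin 2 → ℤ)) :
    ∑ k ∈ F, ∑ σ, ∑ m, mode v k (phase σ) m * flux v k (phase σ) (solenoidalDir k m)
      = transport F v := by
  have hint := hv.integrable one_le_two
  have h1 : ∀ k σ m, Integrable (fun x => mode v k (phase σ) m * ∑ i, v x i *
      inner ℝ (v x) (solenoidalDir k m) *
        trig k ((2 * Real.pi * k i : ℝ) * (Complex.I * phase σ)) x) volume := fun k σ m =>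
    (integrable_finsetSum _ fun i _ => integrable_flux_term hv k _ _ i).const_mul _
  simp only [flux, ← integral_const_mul]
  simp_rw [← integral_finsetSum Finset.univ fun m _ => h1 _ _ m]
  have h2 : ∀ k σ, Integrable (fun x => ∑ m, mode v k (phase σ) m * ∑ i, v x i *
      inner ℝ (v x) (solenoidalDir k m) *
        trig k ((2 * Real.pi * k i : ℝ) * (Complex.I * phase σ)) x) volume := fun k σ =>
    integrable_finsetSum _ fun m _ => h1 k σ m
  simp_rw [← integral_finsetSum Finset.univ fun σ _ => h2 _ σ]
  rw [← integral_finsetSum F fun k _ => integrable_finsetSum _ fun σ _ => h2 k σ, transport]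
  refine integral_congr_ae (ae_of_all _ fun x => ?_)
  have h3 : ∀ k σ, ∑ m, mode v k (phase σ) m * ∑ i, v x i *
      inner ℝ (v x) (solenoidalDir k m) *
        trig k ((2 * Real.pi * k i : ℝ) * (Complex.I * phase σ)) x
      = ∑ i, ∑ j, v x i * v x j * (mode v k (phase σ) j *
        trig k ((2 * Real.pi * k i : ℝ) * (Complex.I * phase σ)) x) := fun k σ => by
    have hm := sum_smul_solenoidalDir (hdiv.mode_orthogonal hint k (phase σ))
    have hm0 := hm 0
    have hm1 := hm 1
    simp only [Fin.sum_univ_two] at hm0 hm1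
    simp only [Fin.sum_univ_two, inner_eq_sum]
    linear_combination (v x 0 * trig k ((2 * Real.pi * k 0 : ℝ) * (Complex.I * phase σ)) x
      + v x 1 * trig k ((2 * Real.pi * k 1 : ℝ) * (Complex.I * phase σ)) x)
      * (v x 0 * hm0 + v x 1 * hm1)
  have h4 : ∀ k i j, trig k (derivCoef i (coef fun y => v y j) k) x = ∑ σ, mode v k (phase σ) j *
        trig k ((2 * Real.pi * k i : ℝ) * (Complex.I * phase σ)) x := fun k i j => by
    rw [derivCoef, trig_ofReal_mul, trig_eq k (_ * _)]
    simp only [Fin.sum_univ_two, trig_ofReal_mul, mode_apply, phase, coef]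
    rw [trig_eq k (Complex.I * ![1, Complex.I] 1)]
    simp
    ring
  simp only [h3, trigSum, h4]
  rw [Finset.sum_congr rfl fun k _ => Finset.sum_comm, Finset.sum_comm]
  refine Finset.sum_congr rfl fun i _ => ?_
  rw [Finset.sum_congr rfl fun k _ => Finset.sum_comm, Finset.sum_comm]
  refine Finset.sum_congr rfl fun j _ => ?_
  simp only [Finset.mul_sum]

/-- Bessel's inequality for the gradient. -/
theorem sum_sq_mul_coef_le {g : Torus2 → Fin 2 → Plane} (hv : MemLp v 2 volume)
    (hg : ∀ i, MemLp (fun x => g x i) 2 volume) (h : IsWeakGradient v g)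
    (F : Finset (Fin 2 → ℤ)) :
    ∑ k ∈ F, (4 * Real.pi ^ 2 * ∑ i, (k i : ℝ) ^ 2) * ∑ m, ‖coef (fun x => v x m) k‖ ^ 2
      ≤ ∑ i, ∑ m, (eLpNorm (fun x => g x i m) 2 volume).toReal ^ 2 := by
  have hint := hv.integrable one_le_two
  have h1 : ∀ i m k, ‖coef (fun x => g x i m) k‖ ^ 2
      = 4 * Real.pi ^ 2 * (k i : ℝ) ^ 2 * ‖coef (fun x => v x m) k‖ ^ 2 := fun i m k => by
    rw [← derivCoef_coef ((memLp_coord hv m).integrable one_le_two)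
      (h.isWeakPartial hint (fun i => (hg i).integrable one_le_two) i m), derivCoef, norm_mul,
      norm_mul, Complex.norm_I, one_mul, mul_pow, Complex.norm_real, Real.norm_eq_abs, sq_abs]
    ring
  calc _ = ∑ i, ∑ m, ∑ k ∈ F, ‖coef (fun x => g x i m) k‖ ^ 2 := by
        simp only [h1, Fin.sum_univ_two, ← Finset.sum_add_distrib]
        exact Finset.sum_congr rfl fun k _ => by ring
    _ ≤ _ := Finset.sum_le_sum fun i _ => Finset.sum_le_sum fun m _ =>
        sum_le_hasSum F (fun _ _ => by positivity) (hasSum_sq_coef (memLp_coord (hg i) m))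

theorem sum_sq_coef_le (hv : MemLp v 2 volume) (F : Finset (Fin 2 → ℤ)) :
    ∑ k ∈ F, ∑ m, ‖coef (fun x => v x m) k‖ ^ 2
      ≤ ∑ m, (eLpNorm (fun x => v x m) 2 volume).toReal ^ 2 := by
  rw [Finset.sum_comm]
  exact Finset.sum_le_sum fun m _ =>
    sum_le_hasSum F (fun _ _ => by positivity) (hasSum_sq_coef (memLp_coord hv m))

theorem tendsto_sum_sq_coef (hv : MemLp v 2 volume) :
    Tendsto (fun F : Finset (Fin 2 → ℤ) => ∑ k ∈ F, ∑ m, ‖coef (fun x => v x m) k‖ ^ 2) atTop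
      (𝓝 (∑ m, (eLpNorm (fun x => v x m) 2 volume).toReal ^ 2)) :=
  hasSum_sum fun m _ => hasSum_sq_coef (memLp_coord hv m)

theorem sum_eLpNorm_coord_sq {α : Type*} [MeasurableSpace α] {μ : Measure α} {w : α → Plane}
    (hw : AEStronglyMeasurable w μ) :
    ∑ m, eLpNorm (fun x => w x m) 2 μ ^ 2 = ∫⁻ x, ‖w x‖ₑ ^ 2 ∂μ := by
  have hm : ∀ m, AEStronglyMeasurable (fun x => w x m) μ := fun m =>
    (EuclideanSpace.proj (𝕜 := ℝ) m).continuous.comp_aestronglyMeasurable hw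
  simp only [eLpNorm_sq_eq_lintegral]
  rw [← lintegral_finsetSum' _ fun m _ => (hm m).enorm.pow_const 2]
  refine lintegral_congr fun x => ?_
  simp only [← ofReal_norm, ← ENNReal.ofReal_pow (norm_nonneg _)]
  rw [← ENNReal.ofReal_sum_of_nonneg fun _ _ => by positivity, EuclideanSpace.norm_sq_eq]

theorem kineticEnergy_eq_sum (hv : AEStronglyMeasurable v volume) :
    kineticEnergy v = 2⁻¹ * ∑ m, eLpNorm (fun x => v x m) 2 volume ^ 2 := by
  rw [kineticEnergy, sum_eLpNorm_coord_sq hv]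

end

/-! ### Space-time norms and time slices. -/

instance (T : ℝ) : IsFiniteMeasure (timeMeasure T) := by
  unfold timeMeasure; infer_instance

instance (T : ℝ) : IsFiniteMeasure (spaceTimeMeasure T) := by
  unfold spaceTimeMeasure; infer_instance

section

variable {T : ℝ} {w : ℝ → Torus2 → Plane}

theorem aemeasurable_eLpNorm_slice
    (hw : AEStronglyMeasurable (fun q : ℝ × Torus2 => w q.1 q.2) (spaceTimeMeasure T)) :
    AEMeasurable (fun t => eLpNorm (w t) 2 volume) (timeMeasure T) := by
  have h1 : AEMeasurable (fun t => ∫⁻ x, ‖w t x‖ₑ ^ 2) (timeMeasure T) :=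
    (hw.enorm.pow_const 2).lintegral_prod_right'
  have h2 : (fun t => eLpNorm (w t) 2 volume) = fun t => (∫⁻ x, ‖w t x‖ₑ ^ 2) ^ (2 : ℝ)⁻¹ := by
    funext t
    rw [← eLpNorm_sq_eq_lintegral, ← ENNReal.rpow_two, ENNReal.rpow_rpow_inv two_ne_zero]
  rw [h2]
  exact h1.pow_const _

theorem lintegral_eLpNorm_sq
    (hw : AEStronglyMeasurable (fun q : ℝ × Torus2 => w q.1 q.2) (spaceTimeMeasure T)) :
    ∫⁻ t, eLpNorm (w t) 2 volume ^ 2 ∂timeMeasure T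
      = eLpNorm (fun q : ℝ × Torus2 => w q.1 q.2) 2 (spaceTimeMeasure T) ^ 2 := by
  rw [eLpNorm_sq_eq_lintegral, spaceTimeMeasure, lintegral_prod _ (hw.enorm.pow_const 2)]
  simp only [eLpNorm_sq_eq_lintegral]

theorem ENNReal_eLpNorm_sq_eq_lintegral {α : Type*} [MeasurableSpace α] (μ : Measure α)
    (f : α → ℝ≥0∞) : eLpNorm f 2 μ ^ 2 = ∫⁻ x, f x ^ 2 ∂μ := by
  have := eLpNorm_nnreal_pow_eq_lintegral (f := f) (μ := μ) (p := 2) two_ne_zero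
  simpa using this

theorem normLpL2_two
    (hw : AEStronglyMeasurable (fun q : ℝ × Torus2 => w q.1 q.2) (spaceTimeMeasure T)) :
    normLpL2 2 T w = eLpNorm (fun q : ℝ × Torus2 => w q.1 q.2) 2 (spaceTimeMeasure T) := by
  have h := lintegral_eLpNorm_sq hw
  rw [← ENNReal_eLpNorm_sq_eq_lintegral] at h
  exact (ENNReal.pow_right_strictMono two_ne_zero).injective h

theorem MemLpL2.memLp_two (h : MemLpL2 2 T w) :
    MemLp (fun q : ℝ × Torus2 => w q.1 q.2) 2 (spaceTimeMeasure T) :=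
  ⟨h.1, by rw [← normLpL2_two h.1]; exact h.2⟩

theorem MemLpL2.two_of_top (h : MemLpL2 ⊤ T w) : MemLpL2 2 T w := by
  refine ⟨h.1, ?_⟩
  have h1 := eLpNorm_le_eLpNorm_mul_rpow_measure_univ (μ := timeMeasure T)
    (le_top : (2 : ℝ≥0∞) ≤ ⊤) (aemeasurable_eLpNorm_slice h.1).aestronglyMeasurable
  refine h1.trans_lt (ENNReal.mul_lt_top h.2 ?_)
  exact ENNReal.rpow_lt_top_of_nonneg (by norm_num) (measure_ne_top _ _)

theorem ae_memLp_slice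
    (h : MemLp (fun q : ℝ × Torus2 => w q.1 q.2) 2 (spaceTimeMeasure T)) :
    ∀ᵐ t ∂timeMeasure T, MemLp (w t) 2 volume := by
  have h1 : ∀ᵐ t ∂timeMeasure T, eLpNorm (w t) 2 volume ^ 2 < ⊤ := by
    refine ae_lt_top' ((aemeasurable_eLpNorm_slice h.1).pow_const 2) ?_
    rw [lintegral_eLpNorm_sq h.1]
    exact ENNReal.pow_ne_top h.2.ne
  filter_upwards [h1, h.1.prodMk_left] with t h1 h2
  exact ⟨h2, by simpa using h1⟩

end

/-! ### The evolution of a single mode. -/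

theorem integral_inner_solenoidalDir {v : Torus2 → Plane} (hv : Integrable v volume)
    (hdiv : WeakDivFree v) (k : Fin 2 → ℤ) (z : ℂ) (m : Fin 2) :
    ∫ x, inner ℝ (v x) (solenoidalDir k m) * trig k z x = mode v k z m := by
  rw [← inner_solenoidalDir (hdiv.mode_orthogonal hv k z) m]
  simp only [inner_eq_sum, Finset.sum_mul]
  have hi : ∀ i, Integrable (fun x => v x i * trig k z x) volume := fun i =>
    integrable_mul_trig (memLp_one_iff_integrable.1
      (memLp_coord (memLp_one_iff_integrable.2 hv) i)) k z
  rw [integral_finsetSum _ fun i _ => by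
    simpa only [mul_right_comm] using (hi i).mul_const (solenoidalDir k m i)]
  refine Finset.sum_congr rfl fun i _ => ?_
  rw [mode_apply, ← integral_mul_const]
  exact integral_congr_ae (ae_of_all _ fun x => by ring)

/-- The eigenvalue of `-Δ` at the frequency `k`. -/
noncomputable def freqSq (k : Fin 2 → ℤ) : ℝ := 4 * Real.pi ^ 2 * ∑ i, (k i : ℝ) ^ 2

/-- The right-hand side of the evolution equation of a mode. -/
noncomputable def modeForce (ν : ℝ) (v : Torus2 → Plane) (k : Fin 2 → ℤ) (z : ℂ) (m : Fin 2) : ℝ :=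
  flux v k z (solenoidalDir k m) - ν * freqSq k * mode v k z m

/-- For the test field `χ(t) trig k z` in a solenoidal direction, `a` is `χ'(t)` and `b` is `χ(t)`;
the spatial integral then has the form required by `ae_eq_primitive`. -/
theorem integral_weak_form_trig {v : Torus2 → Plane} (hv : MemLp v 2 volume)
    (hdiv : WeakDivFree v) (ν a b : ℝ) (k : Fin 2 → ℤ) (z : ℂ) (m : Fin 2) :
    ∫ x, (inner ℝ (v x) (a • trig k z x • solenoidalDir k m)
        + ∑ i : Fin 2, v x i * inner ℝ (v x)
          (b • trig k ((2 * Real.pi * k i : ℝ) * (Complex.I * z)) x • solenoidalDir k m)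
        + ν * inner ℝ (v x) (b • (-(4 * Real.pi ^ 2 * ∑ i, (k i : ℝ) ^ 2) * trig k z x)
          • solenoidalDir k m))
      = a * mode v k z m + b * modeForce ν v k z m := by
  have hint := hv.integrable one_le_two
  have h1 := integrable_mul_trig (hint.inner_const (𝕜 := ℝ) (solenoidalDir k m)) k z
  have h2 : Integrable (fun x => ∑ i, v x i * inner ℝ (v x) (solenoidalDir k m) *
      trig k ((2 * Real.pi * k i : ℝ) * (Complex.I * z)) x) volume :=
    integrable_finsetSum _ fun i _ => integrable_flux_term hv k _ _ i
  have h3 := integral_inner_solenoidalDir hint hdiv k z m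
  calc _ = ∫ x, ((a - b * (ν * freqSq k)) * (inner ℝ (v x) (solenoidalDir k m) * trig k z x)
        + b * ∑ i, v x i * inner ℝ (v x) (solenoidalDir k m) *
          trig k ((2 * Real.pi * k i : ℝ) * (Complex.I * z)) x) := by
        refine integral_congr_ae (ae_of_all _ fun x => ?_)
        simp only [inner_smul_right, Fin.sum_univ_two, freqSq]
        ring
    _ = _ := by
        rw [integral_add (h1.const_mul _) (h2.const_mul _), integral_const_mul,
          integral_const_mul, h3, modeForce, flux]
        ring

section

variable {ν T : ℝ} {u₀ : Torus2 → Plane} {u : ℝ → Torus2 → Plane}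
  {Du : ℝ → Torus2 → Fin 2 → Plane}

theorem IsLerayHopf.memLp_two (hL : IsLerayHopf ν T u₀ u Du) :
    MemLp (fun q : ℝ × Torus2 => u q.1 q.2) 2 (spaceTimeMeasure T) :=
  hL.mem_LinftyL2.two_of_top.memLp_two

theorem integrable_mul_trig_spaceTime {f : ℝ × Torus2 → ℝ}
    (hf : Integrable f (spaceTimeMeasure T)) (k : Fin 2 → ℤ) (z : ℂ) :
    Integrable (fun q => f q * trig k z q.2) (spaceTimeMeasure T) :=
  hf.mul_bdd ((continuous_trig k z).comp continuous_snd).aestronglyMeasurable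
    (ae_of_all _ fun q => abs_trig_le k z q.2)

theorem IsLerayHopf.integrable_mode (hL : IsLerayHopf ν T u₀ u Du) (k : Fin 2 → ℤ) (z : ℂ)
    (m : Fin 2) : Integrable (fun t => mode (u t) k z m) (timeMeasure T) :=
  (integrable_mul_trig_spaceTime ((memLp_coord hL.memLp_two m).integrable one_le_two)
    k z).integral_prod_left

theorem IsLerayHopf.integrable_flux (hL : IsLerayHopf ν T u₀ u Du) (k : Fin 2 → ℤ) (z : ℂ)
    (d : Plane) : Integrable (fun t => flux (u t) k z d) (timeMeasure T) := by
  have h : Integrable (fun q : ℝ × Torus2 => ∑ i, u q.1 q.2 i * inner ℝ (u q.1 q.2) d *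
      trig k ((2 * Real.pi * k i : ℝ) * (Complex.I * z)) q.2) (spaceTimeMeasure T) :=
    integrable_finsetSum _ fun i _ => integrable_mul_trig_spaceTime
      ((memLp_coord hL.memLp_two i).integrable_mul (hL.memLp_two.inner_const d)) _ _
  exact h.integral_prod_left

theorem IsLerayHopf.integrable_modeForce (hL : IsLerayHopf ν T u₀ u Du) (k : Fin 2 → ℤ) (z : ℂ)
    (m : Fin 2) : Integrable (fun t => modeForce ν (u t) k z m) (timeMeasure T) :=
  (hL.integrable_flux k z _).sub ((hL.integrable_mode k z m).const_mul _)

/-- The evolution equation of the modes. -/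
theorem IsLerayHopf.ae_mode_eq (hL : IsLerayHopf ν T u₀ u Du) (hT : 0 < T) (k : Fin 2 → ℤ)
    (z : ℂ) (m : Fin 2) :
    ∀ᵐ t ∂timeMeasure T, mode (u t) k z m
      = mode u₀ k z m + ∫ s in (0 : ℝ)..t, modeForce ν (u s) k z m := by
  refine ae_eq_primitive hT (hL.integrable_mode k z m) (hL.integrable_modeForce k z m) ?_
  intro χ hχ hsupp
  have h := hL.weak_form _ (isTestField_trig hχ hsupp z (sum_mul_solenoidalDir k m))
  have h0 : ∫ x, inner ℝ (u₀ x) (χ 0 • trig k z x • solenoidalDir k m)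
      = χ 0 * mode u₀ k z m := by
    rw [← integral_inner_solenoidalDir (hL.init_memLp.integrable one_le_two) hL.init_div_free,
      ← integral_const_mul]
    refine integral_congr_ae (ae_of_all _ fun x => ?_)
    simp only [inner_smul_right]
    ring
  rw [h0] at h
  rw [← h]
  refine integral_congr_ae ?_
  filter_upwards [ae_memLp_slice hL.memLp_two, hL.div_free] with t hv hdiv
  rw [← integral_weak_form_trig hv hdiv]
  have hd : ∀ x, deriv (fun s => χ s • trig k z x • solenoidalDir k m) t
      = deriv χ t • trig k z x • solenoidalDir k m := fun x =>
    deriv_smul_const ((hχ.differentiable (by simp)) t) _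
  simp only [hd, torusPartial_trig_smul, torusLaplacian_trig_smul]

end

/-! ### The truncated energy balance and the reverse energy inequality. -/

theorem ofReal_integral_le_lintegral {α : Type*} [MeasurableSpace α] {μ : Measure α} (f : α → ℝ) :
    ENNReal.ofReal (∫ x, f x ∂μ) ≤ ∫⁻ x, ENNReal.ofReal (f x) ∂μ := by
  by_cases hf : Integrable f μ
  · rw [integral_eq_lintegral_pos_part_sub_lintegral_neg_part hf]
    exact (ENNReal.ofReal_le_ofReal (sub_le_self _ ENNReal.toReal_nonneg)).trans
      ENNReal.ofReal_toReal_le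
  -- A non-integrable function has integral 0 by convention, so no integrability hypothesis is
  -- needed.
  · simp [integral_undef hf]

/-- The energy of the Fourier modes in `F`, counted twice. -/
noncomputable def modeEnergy (F : Finset (Fin 2 → ℤ)) (v : Torus2 → Plane) : ℝ :=
  ∑ k ∈ F, ∑ m, ‖coef (fun x => v x m) k‖ ^ 2

/-- The enstrophy of the Fourier modes in `F`. -/
noncomputable def modeEnstrophy (F : Finset (Fin 2 → ℤ)) (v : Torus2 → Plane) : ℝ :=
  ∑ k ∈ F, freqSq k * ∑ m, ‖coef (fun x => v x m) k‖ ^ 2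

theorem modeEnergy_eq (F : Finset (Fin 2 → ℤ)) (v : Torus2 → Plane) :
    modeEnergy F v = ∑ k ∈ F, ∑ σ, ∑ m, mode v k (phase σ) m ^ 2 := by
  simp only [modeEnergy, norm_coef_sq]
  exact Finset.sum_congr rfl fun k _ => Finset.sum_comm

theorem sum_mode_mul_modeForce {v : Torus2 → Plane} (hv : MemLp v 2 volume)
    (hdiv : WeakDivFree v) (ν : ℝ) (F : Finset (Fin 2 → ℤ)) :
    ∑ k ∈ F, ∑ σ, ∑ m, 2 * (mode v k (phase σ) m * modeForce ν v k (phase σ) m)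
      = 2 * (transport F v - ν * modeEnstrophy F v) := by
  rw [← sum_mode_mul_flux hv hdiv, modeEnstrophy]
  simp only [norm_coef_sq, modeForce, Finset.mul_sum, mul_sub, Finset.sum_sub_distrib]
  congr 1
  refine Finset.sum_congr rfl fun k _ => ?_
  rw [Finset.sum_comm]
  exact Finset.sum_congr rfl fun m _ => Finset.sum_congr rfl fun σ _ => by ring

section

variable {ν T : ℝ} {u₀ : Torus2 → Plane} {u : ℝ → Torus2 → Plane}
  {Du : ℝ → Torus2 → Fin 2 → Plane}

theorem IsLerayHopf.integrable_mode_mul (hL : IsLerayHopf ν T u₀ u Du) (hT : 0 < T)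
    (k : Fin 2 → ℤ) (z : ℂ) (m : Fin 2) {f : ℝ → ℝ} (hf : Integrable f (timeMeasure T)) :
    Integrable (fun t => mode (u t) k z m * f t) (timeMeasure T) :=
  integrable_mul_of_ae_eq_primitive hT.le (hL.integrable_modeForce k z m)
    (hL.ae_mode_eq hT k z m) hf

theorem IsLerayHopf.ae_modeEnergy_eq (hL : IsLerayHopf ν T u₀ u Du) (hT : 0 < T)
    (F : Finset (Fin 2 → ℤ)) :
    ∀ᵐ t ∂timeMeasure T, modeEnergy F (u t) = modeEnergy F u₀
      + ∫ s in (0 : ℝ)..t, 2 * (transport F (u s) - ν * modeEnstrophy F (u s)) := by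
  have h1 : ∀ᵐ t ∂timeMeasure T, ∀ k : Fin 2 → ℤ, ∀ σ m, mode (u t) k (phase σ) m ^ 2
      = mode u₀ k (phase σ) m ^ 2 + ∫ s in (0 : ℝ)..t,
        2 * (mode (u s) k (phase σ) m * modeForce ν (u s) k (phase σ) m) := by
    simp only [ae_all_iff]
    exact fun k σ m => ae_sq_eq_primitive hT (hL.integrable_modeForce k _ m)
      (hL.ae_mode_eq hT k _ m)
  have hmem : ∀ᵐ t ∂timeMeasure T, t ∈ Set.Icc 0 T := ae_restrict_mem measurableSet_Icc
  have h2 : ∀ᵐ s ∂timeMeasure T,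
      ∑ k ∈ F, ∑ σ, ∑ m, 2 * (mode (u s) k (phase σ) m * modeForce ν (u s) k (phase σ) m)
        = 2 * (transport F (u s) - ν * modeEnstrophy F (u s)) := by
    filter_upwards [ae_memLp_slice hL.memLp_two, hL.div_free] with s hv hdiv
    exact sum_mode_mul_modeForce hv hdiv ν F
  filter_upwards [h1, hmem] with t ht htmem
  have hsub : Set.uIoc 0 t ⊆ Set.Icc 0 T := by
    rw [Set.uIoc_of_le htmem.1]
    exact fun s hs => ⟨hs.1.le, hs.2.trans htmem.2⟩
  have hint : ∀ k σ m, IntervalIntegrable (fun s =>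
      2 * (mode (u s) k (phase σ) m * modeForce ν (u s) k (phase σ) m)) volume 0 t :=
    fun k σ m => by
      rw [intervalIntegrable_iff]
      exact IntegrableOn.mono_set (t := Set.Icc 0 T) ((hL.integrable_mode_mul hT k _ m
        (hL.integrable_modeForce k _ m)).const_mul 2) hsub
  have hint2 : ∀ k σ, IntervalIntegrable (fun s => ∑ m,
      2 * (mode (u s) k (phase σ) m * modeForce ν (u s) k (phase σ) m)) volume 0 t :=
    fun k σ => by simpa only [Fin.sum_univ_two] using (hint k σ 0).add (hint k σ 1)
  have hint3 : ∀ k, IntervalIntegrable (fun s => ∑ σ, ∑ m,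
      2 * (mode (u s) k (phase σ) m * modeForce ν (u s) k (phase σ) m)) volume 0 t :=
    fun k => by simpa only [Fin.sum_univ_two] using (hint2 k 0).add (hint2 k 1)
  have h3 : ∫ s in (0 : ℝ)..t, 2 * (transport F (u s) - ν * modeEnstrophy F (u s))
      = ∫ s in (0 : ℝ)..t, ∑ k ∈ F, ∑ σ, ∑ m,
        2 * (mode (u s) k (phase σ) m * modeForce ν (u s) k (phase σ) m) := by
    refine intervalIntegral.integral_congr_ae ?_
    filter_upwards [(ae_restrict_iff' measurableSet_Icc).1 h2] with s hs hsmem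
    exact (hs (hsub hsmem)).symm
  rw [h3, intervalIntegral.integral_finsetSum fun k _ => hint3 k, modeEnergy_eq, modeEnergy_eq,
    ← Finset.sum_add_distrib]
  refine Finset.sum_congr rfl fun k _ => ?_
  rw [intervalIntegral.integral_finsetSum fun σ _ => hint2 k σ, ← Finset.sum_add_distrib]
  refine Finset.sum_congr rfl fun σ _ => ?_
  rw [intervalIntegral.integral_finsetSum fun m _ => hint k σ m, ← Finset.sum_add_distrib]
  exact Finset.sum_congr rfl fun m _ => ht k σ m

/-- Measurability in time is read off from the finite sum of modes times fluxes that equals the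
transport term almost everywhere. -/
theorem IsLerayHopf.aemeasurable_transport (hL : IsLerayHopf ν T u₀ u Du) (hT : 0 < T)
    (F : Finset (Fin 2 → ℤ)) :
    AEMeasurable (fun t => ‖transport F (u t)‖ₑ) (timeMeasure T) := by
  have h : Integrable (fun t => ∑ k ∈ F, ∑ σ, ∑ m,
      mode (u t) k (phase σ) m * flux (u t) k (phase σ) (solenoidalDir k m)) (timeMeasure T) :=
    integrable_finsetSum _ fun k _ => integrable_finsetSum _ fun σ _ =>
      integrable_finsetSum _ fun m _ => hL.integrable_mode_mul hT k _ m (hL.integrable_flux k _ _)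
  refine AEMeasurable.enorm (h.1.aemeasurable.congr ?_)
  filter_upwards [ae_memLp_slice hL.memLp_two, hL.div_free] with t hv hdiv
  exact sum_mode_mul_flux hv hdiv F

theorem IsLerayHopf.ae_gradient (hL : IsLerayHopf ν T u₀ u Du) :
    ∀ᵐ t ∂timeMeasure T, ∀ i, MemLp (fun x => Du t x i) 2 volume :=
  ae_all_iff.2 fun i => ae_memLp_slice (hL.gradient_mem i).memLp_two

theorem ofReal_modeEnergy_le {v : Torus2 → Plane} (hv : MemLp v 2 volume)
    (F : Finset (Fin 2 → ℤ)) :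
    ENNReal.ofReal (1 / 2 * modeEnergy F v) ≤ kineticEnergy v := by
  rw [kineticEnergy_eq_sum hv.1, ENNReal.ofReal_mul (by norm_num)]
  refine mul_le_mul' ?_ ((ENNReal.ofReal_le_ofReal (sum_sq_coef_le hv F)).trans ?_)
  · rw [one_div, ENNReal.ofReal_inv_of_pos two_pos, ENNReal.ofReal_ofNat]
  · rw [ENNReal.ofReal_sum_of_nonneg fun _ _ => by positivity]
    refine Finset.sum_le_sum fun m _ => ?_
    rw [ENNReal.ofReal_pow ENNReal.toReal_nonneg, ENNReal.ofReal_toReal (memLp_coord hv m).2.ne]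

theorem tendsto_ofReal_modeEnergy {v : Torus2 → Plane} (hv : MemLp v 2 volume) :
    Tendsto (fun F => ENNReal.ofReal (1 / 2 * modeEnergy F v)) atTop (𝓝 (kineticEnergy v)) := by
  have h := (ENNReal.continuous_ofReal.tendsto _).comp ((tendsto_sum_sq_coef hv).const_mul (1 / 2))
  have h2 : ENNReal.ofReal (1 / 2 * ∑ m, (eLpNorm (fun x => v x m) 2 volume).toReal ^ 2)
      = kineticEnergy v := by
    rw [kineticEnergy_eq_sum hv.1, ENNReal.ofReal_mul (by norm_num), one_div,
      ENNReal.ofReal_inv_of_pos two_pos, ENNReal.ofReal_ofNat,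
      ENNReal.ofReal_sum_of_nonneg fun _ _ => by positivity]
    congr 1
    refine Finset.sum_congr rfl fun m _ => ?_
    rw [ENNReal.ofReal_pow ENNReal.toReal_nonneg, ENNReal.ofReal_toReal (memLp_coord hv m).2.ne]
  rwa [h2] at h

theorem ofReal_modeEnstrophy_le {v : Torus2 → Plane} {g : Torus2 → Fin 2 → Plane}
    (hv : MemLp v 2 volume) (hg : ∀ i, MemLp (fun x => g x i) 2 volume)
    (h : IsWeakGradient v g) (F : Finset (Fin 2 → ℤ)) :
    ENNReal.ofReal (modeEnstrophy F v) ≤ ∫⁻ x, ∑ i : Fin 2, ‖g x i‖ₑ ^ 2 := by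
  rw [lintegral_finsetSum' _ fun i _ => (hg i).1.enorm.pow_const 2]
  refine (ENNReal.ofReal_le_ofReal (sum_sq_mul_coef_le hv hg h F)).trans ?_
  rw [ENNReal.ofReal_sum_of_nonneg fun _ _ => by positivity]
  refine Finset.sum_le_sum fun i _ => ?_
  rw [← sum_eLpNorm_coord_sq (hg i).1, ENNReal.ofReal_sum_of_nonneg fun _ _ => by positivity]
  refine Finset.sum_le_sum fun m _ => ?_
  rw [ENNReal.ofReal_pow ENNReal.toReal_nonneg,
    ENNReal.ofReal_toReal (memLp_coord (hg i) m).2.ne]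

/-- The truncated energy and enstrophy are bounded by the full ones, by Bessel. The error is
integrated over the whole interval, so it does not depend on `t`. -/
theorem IsLerayHopf.ae_modeEnergy_le (hL : IsLerayHopf ν T u₀ u Du) (hT : 0 < T) (hν : 0 < ν)
    (F : Finset (Fin 2 → ℤ)) :
    ∀ᵐ t ∂timeMeasure T, ENNReal.ofReal (1 / 2 * modeEnergy F u₀)
      ≤ kineticEnergy (u t) + dissipation ν t Du
        + ∫⁻ s, ‖transport F (u s)‖ₑ ∂timeMeasure T := by
  have hmem : ∀ᵐ t ∂timeMeasure T, t ∈ Set.Icc 0 T := ae_restrict_mem measurableSet_Icc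
  filter_upwards [hL.ae_modeEnergy_eq hT F, hmem, ae_memLp_slice hL.memLp_two] with t ht htmem hv
  have hle : volume.restrict (Set.Icc 0 t) ≤ timeMeasure T :=
    Measure.restrict_mono (Set.Icc_subset_Icc_right htmem.2) le_rfl
  have h1 : 1 / 2 * modeEnergy F u₀ = 1 / 2 * modeEnergy F (u t)
      + ∫ s in Set.Icc 0 t, (ν * modeEnstrophy F (u s) - transport F (u s)) := by
    have h0 : ∫ s in (0 : ℝ)..t, (ν * modeEnstrophy F (u s) - transport F (u s))
        = -(1 / 2) * ∫ s in (0 : ℝ)..t, 2 * (transport F (u s) - ν * modeEnstrophy F (u s)) := by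
      rw [← intervalIntegral.integral_const_mul]
      exact intervalIntegral.integral_congr fun s _ => by ring
    rw [ht, integral_Icc_eq_integral_Ioc, ← intervalIntegral.integral_of_le htmem.1, h0]
    ring
  have h2 : ∀ᵐ s ∂volume.restrict (Set.Icc 0 t),
      ENNReal.ofReal (ν * modeEnstrophy F (u s) - transport F (u s))
        ≤ ENNReal.ofReal ν * (∫⁻ x, ∑ i : Fin 2, ‖Du s x i‖ₑ ^ 2) + ‖transport F (u s)‖ₑ := by
    refine ae_mono hle ?_
    filter_upwards [ae_memLp_slice hL.memLp_two, hL.ae_gradient, hL.gradient] with s h1 h2 h3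
    calc _ ≤ ENNReal.ofReal (ν * modeEnstrophy F (u s)) + ENNReal.ofReal (-transport F (u s)) := by
          rw [sub_eq_add_neg]
          exact ENNReal.ofReal_add_le
      _ ≤ _ := by
          rw [ENNReal.ofReal_mul hν.le]
          refine add_le_add (mul_le_mul' le_rfl (ofReal_modeEnstrophy_le h1 h2 h3 F)) ?_
          rw [Real.enorm_eq_ofReal_abs]
          exact ENNReal.ofReal_le_ofReal (neg_le_abs _)
  rw [h1]
  refine ENNReal.ofReal_add_le.trans ?_
  rw [add_assoc]
  refine add_le_add (ofReal_modeEnergy_le hv F) ?_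
  refine (ofReal_integral_le_lintegral _).trans ((lintegral_mono_ae h2).trans ?_)
  rw [lintegral_add_right' _ ((hL.aemeasurable_transport hT F).mono_measure hle), dissipation,
    lintegral_const_mul' _ _ ENNReal.ofReal_ne_top]
  exact add_le_add le_rfl (lintegral_mono' hle le_rfl)

theorem gradNorm_sq_le {g : Torus2 → Fin 2 → Plane} (hg : ∀ i, MemLp (fun x => g x i) 2 volume) :
    gradNorm g ^ 2 ≤ 9 * ∑ i, eLpNorm (fun x => g x i) 2 volume ^ 2 := by
  have hsq : ∀ a b : ℝ≥0∞, (a + b) ^ 2 ≤ 3 * (a ^ 2 + b ^ 2) := fun a b => by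
    calc (a + b) ^ 2 = a ^ 2 + b ^ 2 + 2 * (a * b) := by ring
      _ ≤ a ^ 2 + b ^ 2 + 2 * (a ^ 2 + b ^ 2) := by gcongr; exact ENNReal_mul_le_add_sq a b
      _ = _ := by ring
  have h1 : ∀ i, eLpNorm (fun x => g x i) 2 volume ^ 2
      = ∑ j, eLpNorm (fun x => g x i j) 2 volume ^ 2 := fun i => by
    rw [sum_eLpNorm_coord_sq (hg i).1, eLpNorm_sq_eq_lintegral]
  simp only [gradNorm, h1, Fin.sum_univ_two]
  refine (hsq _ _).trans ((mul_le_mul' le_rfl (add_le_add (hsq _ _) (hsq _ _))).trans_eq ?_)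
  ring

/-- With `M` bounding `‖u(t)‖₂` and `G` the gradient norm, the transport term is at most `5(M²G +
2MG²)`. This is integrable because `G²` is and `G ≤ 1 + G²`; dominated convergence along finite
frequency sets concludes. -/
theorem IsLerayHopf.tendsto_lintegral_transport (hL : IsLerayHopf ν T u₀ u Du) (hT : 0 < T) :
    Tendsto (fun F => ∫⁻ s, ‖transport F (u s)‖ₑ ∂timeMeasure T) atTop (𝓝 0) := by
  set M : ℝ≥0∞ := normLpL2 ⊤ T u with hM
  have hMt : M ≠ ⊤ := hL.mem_LinftyL2.2.ne
  have haeM : ∀ᵐ t ∂timeMeasure T, eLpNorm (u t) 2 volume ≤ M := by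
    rw [hM, normLpL2, eLpNorm_exponent_top]
    exact enorm_ae_le_eLpNormEssSup (fun t => eLpNorm (u t) 2 volume) _
  set S : ℝ → ℝ≥0∞ := fun t => 9 * ∑ i, eLpNorm (fun x => Du t x i) 2 volume ^ 2 with hS
  have hSm : AEMeasurable S (timeMeasure T) :=
    (Finset.aemeasurable_fun_sum _ fun i _ =>
      (aemeasurable_eLpNorm_slice (hL.gradient_mem i).1).pow_const 2).const_mul 9
  have hSint : ∫⁻ t, S t ∂timeMeasure T ≠ ⊤ := by
    rw [lintegral_const_mul' _ _ ENNReal.ofNat_ne_top, lintegral_finsetSum' _ fun i _ =>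
      (aemeasurable_eLpNorm_slice (hL.gradient_mem i).1).pow_const 2]
    refine ENNReal.mul_ne_top ENNReal.ofNat_ne_top (ENNReal.sum_ne_top.2 fun i _ => ?_)
    rw [lintegral_eLpNorm_sq (w := fun t x => Du t x i) (hL.gradient_mem i).1]
    exact ENNReal.pow_ne_top (hL.gradient_mem i).memLp_two.2.ne
  rw [show (0 : ℝ≥0∞) = ∫⁻ _, 0 ∂timeMeasure T by simp]
  refine tendsto_lintegral_filter_of_dominated_convergence'
    (fun t => 5 * (M ^ 2 * (1 + S t) + 2 * (M * S t)))
    (Eventually.of_forall fun F => hL.aemeasurable_transport hT F)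
    (Eventually.of_forall fun F => ?_) ?_ ?_
  · filter_upwards [ae_memLp_slice hL.memLp_two, hL.ae_gradient, hL.gradient, hL.div_free, haeM]
      with s h1 h2 h3 h4 h5
    refine (enorm_transport_le_gradNorm h1 h4 h2 h3 F).trans ?_
    have hd2 : gradNorm (Du s) ^ 2 ≤ S s := gradNorm_sq_le h2
    have hd1 : gradNorm (Du s) ≤ 1 + S s := by
      have := ENNReal_mul_le_add_sq 1 (gradNorm (Du s))
      rw [one_mul, one_pow] at this
      exact this.trans (add_le_add le_rfl hd2)
    calc _ ≤ 5 * (M ^ 2 + 2 * (M * gradNorm (Du s))) * gradNorm (Du s) := by gcongr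
      _ = 5 * (M ^ 2 * gradNorm (Du s) + 2 * (M * gradNorm (Du s) ^ 2)) := by ring
      _ ≤ _ := by gcongr
  · rw [lintegral_const_mul' _ _ ENNReal.ofNat_ne_top,
      lintegral_add_left' ((hSm.const_add 1).const_mul _),
      lintegral_const_mul' _ _ (ENNReal.pow_ne_top hMt),
      lintegral_const_mul' _ _ ENNReal.ofNat_ne_top,
      lintegral_const_mul' _ _ hMt, lintegral_add_left' aemeasurable_const, lintegral_const]
    finiteness
  · filter_upwards [ae_memLp_slice hL.memLp_two, hL.ae_gradient, hL.gradient, hL.div_free]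
      with s h1 h2 h3 h4
    exact tendsto_transport h1 h4 h2 h3

/-- In two dimensions Leray–Hopf solutions satisfy the reverse energy inequality. -/
theorem IsLerayHopf.ae_le_energy (hL : IsLerayHopf ν T u₀ u Du) (hT : 0 < T) (hν : 0 < ν) :
    ∀ᵐ t ∂timeMeasure T, kineticEnergy u₀ ≤ kineticEnergy (u t) + dissipation ν t Du := by
  -- There are countably many finite frequency sets, so one null set of times serves them all.
  filter_upwards [ae_all_iff.2 fun F => hL.ae_modeEnergy_le hT hν F] with t ht
  have h1 := (hL.tendsto_lintegral_transport hT).const_add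
    (kineticEnergy (u t) + dissipation ν t Du)
  rw [add_zero] at h1
  exact le_of_tendsto_of_tendsto' (tendsto_ofReal_modeEnergy hL.init_memLp) h1 ht

end

/-! ### Convergence of norms and almost everywhere subsequences. -/

theorem tendsto_eLpNorm_of_tendsto_sub {α E ι : Type*} [MeasurableSpace α] {μ : Measure α}
    [NormedAddCommGroup E] {l : Filter ι} {p : ℝ≥0∞} (hp : 1 ≤ p) {f : ι → α → E} {g : α → E}
    (hf : ∀ j, AEStronglyMeasurable (f j) μ) (hg : MemLp g p μ)
    (h : Tendsto (fun j => eLpNorm (fun x => f j x - g x) p μ) l (𝓝 0)) :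
    Tendsto (fun j => eLpNorm (f j) p μ) l (𝓝 (eLpNorm g p μ)) := by
  have hup : Tendsto (fun j => eLpNorm g p μ + eLpNorm (fun x => f j x - g x) p μ) l
      (𝓝 (eLpNorm g p μ)) := by simpa using h.const_add (eLpNorm g p μ)
  have hlow : Tendsto (fun j => eLpNorm g p μ - eLpNorm (fun x => f j x - g x) p μ) l
      (𝓝 (eLpNorm g p μ)) := by
    simpa using ENNReal.Tendsto.sub tendsto_const_nhds h (Or.inl hg.2.ne)
  refine tendsto_of_tendsto_of_tendsto_of_le_of_le hlow hup (fun j => ?_) fun j => ?_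
  · rw [tsub_le_iff_right]
    calc eLpNorm g p μ = eLpNorm (f j - (f j - g)) p μ := by rw [sub_sub_cancel]
      _ ≤ _ := eLpNorm_sub_le (hf j) ((hf j).sub hg.1) hp
  · calc eLpNorm (f j) p μ = eLpNorm (g + (f j - g)) p μ := by rw [add_sub_cancel]
      _ ≤ _ := eLpNorm_add_le hg.1 ((hf j).sub hg.1) hp

theorem kineticEnergy_eq (f : Torus2 → Plane) :
    kineticEnergy f = 2⁻¹ * eLpNorm f 2 volume ^ 2 := by
  rw [kineticEnergy, eLpNorm_sq_eq_lintegral]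

theorem two_mul_kineticEnergy (f : Torus2 → Plane) :
    2 * kineticEnergy f = eLpNorm f 2 volume ^ 2 := by
  rw [kineticEnergy_eq, ← mul_assoc, ENNReal.mul_inv_cancel two_ne_zero ENNReal.ofNat_ne_top,
    one_mul]

theorem tendsto_kineticEnergy {ι : Type*} {l : Filter ι} {f : ι → Torus2 → Plane}
    {g : Torus2 → Plane} (hf : ∀ j, AEStronglyMeasurable (f j) volume) (hg : MemLp g 2 volume)
    (h : Tendsto (fun j => eLpNorm (fun x => f j x - g x) 2 volume) l (𝓝 0)) :
    Tendsto (fun j => kineticEnergy (f j)) l (𝓝 (kineticEnergy g)) := by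
  simp only [kineticEnergy_eq]
  exact ENNReal.Tendsto.const_mul ((ENNReal.continuous_pow 2).tendsto _ |>.comp
    (tendsto_eLpNorm_of_tendsto_sub one_le_two hf hg h)) (Or.inr (by simp))

theorem exists_subseq_tendsto_ae_zero {α : Type*} [MeasurableSpace α] {μ : Measure α}
    {a : ℕ → α → ℝ≥0∞} (ha : ∀ n, AEMeasurable (a n) μ)
    (h : Tendsto (fun n => ∫⁻ x, a n x ∂μ) atTop (𝓝 0)) :
    ∃ ns : ℕ → ℕ, StrictMono ns ∧ ∀ᵐ x ∂μ, Tendsto (fun k => a (ns k) x) atTop (𝓝 0) := by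
  -- With integrals at most `2⁻ᵏ`, the sum of the subsequence is integrable, hence finite almost
  -- everywhere, and its terms tend to zero.
  obtain ⟨ns, hns, hle⟩ := extraction_forall_of_eventually'
    (P := fun k n => ∫⁻ x, a n x ∂μ ≤ (2⁻¹ : ℝ≥0∞) ^ k) fun k => by
      have := h.eventually (gt_mem_nhds (ENNReal.pow_pos (a := 2⁻¹) (by simp) k))
      obtain ⟨N, hN⟩ := eventually_atTop.1 this
      exact ⟨N, fun n hn => (hN n hn).le⟩
  refine ⟨ns, hns, ?_⟩
  have hsum : ∫⁻ x, ∑' k, a (ns k) x ∂μ ≠ ⊤ := by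
    rw [lintegral_tsum fun k => ha _]
    refine ne_top_of_le_ne_top ?_ (ENNReal.tsum_le_tsum hle)
    rw [ENNReal.tsum_geometric]
    simp
  filter_upwards [ae_lt_top' (AEMeasurable.tsum fun k => ha (ns k)) hsum] with x hx
  exact ENNReal.tendsto_atTop_zero_of_tsum_ne_top hx.ne

/-- Boundedness and convergence in `L²` imply convergence in `Lᵖ` for all finite `p`. -/
theorem tendsto_eLpNorm_of_bounded {α ι : Type*} [MeasurableSpace α] {μ : Measure α}
    [IsFiniteMeasure μ] {l : Filter ι} {a : ι → α → ℝ≥0∞} (ha : ∀ j, AEMeasurable (a j) μ)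
    {K : ℝ≥0∞} (hK : K ≠ ⊤) (hbound : ∀ᶠ j in l, ∀ᵐ x ∂μ, a j x ≤ K)
    (h : Tendsto (fun j => eLpNorm (a j) 2 μ) l (𝓝 0)) {p : ℝ≥0∞} (hp1 : 1 ≤ p) (hp : p ≠ ⊤) :
    Tendsto (fun j => eLpNorm (a j) p μ) l (𝓝 0) := by
  rcases le_total p 2 with hp2 | hp2
  · have h1 := ENNReal.Tendsto.mul_const (b := μ Set.univ ^ (1 / p.toReal - 1 / (2 : ℝ≥0∞).toReal))
      h (Or.inr ?_)
    · rw [zero_mul] at h1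
      exact tendsto_of_tendsto_of_tendsto_of_le_of_le tendsto_const_nhds h1 (fun _ => zero_le)
        fun j => eLpNorm_le_eLpNorm_mul_rpow_measure_univ hp2 (ha j).aestronglyMeasurable
    · refine ENNReal.rpow_ne_top_of_nonneg (sub_nonneg.2 ?_) (measure_ne_top μ _)
      exact one_div_le_one_div_of_le
        (zero_lt_one.trans_le (by simpa using ENNReal.toReal_mono hp hp1))
        (ENNReal.toReal_mono ENNReal.ofNat_ne_top hp2)
  -- Interpolation with the uniform bound: `aᵖ ≤ Kᵖ⁻² a²`.
  · have hpr : 2 ≤ p.toReal := by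
      simpa using ENNReal.toReal_mono hp hp2
    have hp0 : p ≠ 0 := fun h0 => by simp [h0] at hpr; linarith
    have h1 : Tendsto (fun j => (K ^ (p.toReal - 2) * eLpNorm (a j) 2 μ ^ 2) ^ (1 / p.toReal)) l
        (𝓝 0) := by
      have h2 := (ENNReal.continuous_rpow_const (y := 1 / p.toReal).tendsto _).comp
        (ENNReal.Tendsto.const_mul (a := K ^ (p.toReal - 2))
          ((ENNReal.continuous_pow 2).tendsto _ |>.comp h)
          (Or.inr (ENNReal.rpow_ne_top_of_nonneg (by linarith) hK)))
      simp only [ne_eq, OfNat.ofNat_ne_zero, not_false_eq_true, zero_pow, mul_zero] at h2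
      rwa [ENNReal.zero_rpow_of_pos (by positivity)] at h2
    refine tendsto_of_tendsto_of_tendsto_of_le_of_le' tendsto_const_nhds h1
      (Eventually.of_forall fun _ => zero_le) ?_
    filter_upwards [hbound] with j hj
    rw [eLpNorm_eq_lintegral_rpow_enorm_toReal hp0 hp, ENNReal_eLpNorm_sq_eq_lintegral,
      ← lintegral_const_mul' _ _ (ENNReal.rpow_ne_top_of_nonneg (by linarith) hK)]
    refine ENNReal.rpow_le_rpow (lintegral_mono_ae ?_) (by positivity)
    filter_upwards [hj] with x hx
    calc ‖a j x‖ₑ ^ p.toReal = a j x ^ (p.toReal - 2) * a j x ^ (2 : ℝ) := by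
          rw [← ENNReal.rpow_add_of_nonneg _ _ (by linarith) (by norm_num), sub_add_cancel,
            enorm_eq_self]
      _ ≤ _ := by
          rw [ENNReal.rpow_two]
          gcongr

/-! ### The two implications. -/

section

variable {ι : Type*} {l : Filter ι} {T : ℝ} {ν : ι → ℝ} {u₀ν : ι → Torus2 → Plane}
  {u₀ : Torus2 → Plane} {uν : ι → ℝ → Torus2 → Plane} {Duν : ι → ℝ → Torus2 → Fin 2 → Plane}
  {u : ℝ → Torus2 → Plane}

theorem IsLerayHopf.ae_kineticEnergy_le {ν : ℝ} {u₀ : Torus2 → Plane} {u : ℝ → Torus2 → Plane}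
    {Du : ℝ → Torus2 → Fin 2 → Plane} (hL : IsLerayHopf ν T u₀ u Du) :
    ∀ᵐ t ∂timeMeasure T, kineticEnergy (u t) ≤ kineticEnergy u₀ :=
  hL.energy_le.mono fun _ ht => le_self_add.trans ht

theorem dissipation_mono (ν : ℝ) (Du : ℝ → Torus2 → Fin 2 → Plane) {s t : ℝ} (hst : s ≤ t) :
    dissipation ν s Du ≤ dissipation ν t Du :=
  mul_le_mul' le_rfl (lintegral_mono_set (Set.Icc_subset_Icc_right hst))

theorem lintegral_two_mul_kineticEnergy {w : ℝ → Torus2 → Plane}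
    (hw : AEStronglyMeasurable (fun q : ℝ × Torus2 => w q.1 q.2) (spaceTimeMeasure T)) :
    ∫⁻ t, 2 * kineticEnergy (w t) ∂timeMeasure T
      = eLpNorm (fun q : ℝ × Torus2 => w q.1 q.2) 2 (spaceTimeMeasure T) ^ 2 := by
  simp only [two_mul_kineticEnergy]
  exact lintegral_eLpNorm_sq hw

theorem eLpNorm_le_of_kineticEnergy_le {f g : Torus2 → Plane}
    (h : kineticEnergy f ≤ kineticEnergy g) : eLpNorm f 2 volume ≤ eLpNorm g 2 volume := by
  rw [← ENNReal.pow_le_pow_left_iff two_ne_zero, ← two_mul_kineticEnergy, ← two_mul_kineticEnergy]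
  exact mul_le_mul' le_rfl h

/-- Weak convergence together with convergence of the upper bounds for the energy gives strong
convergence in `L²` of space-time. -/
theorem tendsto_eLpNorm_spaceTime
    (hLH : ∀ j, IsLerayHopf (ν j) T (u₀ν j) (uν j) (Duν j)) (hu₀ : MemLp u₀ 2 volume)
    (hu₀_lim : Tendsto (fun j => eLpNorm (fun x => u₀ν j x - u₀ x) 2 volume) l (𝓝 0))
    (hu : MemLp (fun q : ℝ × Torus2 => u q.1 q.2) 2 (spaceTimeMeasure T))
    (hu_lim : WeakTendstoL2 T l uν u)
    (hE : ∀ᵐ t ∂timeMeasure T, kineticEnergy (u t) = kineticEnergy u₀) :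
    Tendsto (fun j => eLpNorm (fun q : ℝ × Torus2 => uν j q.1 q.2 - u q.1 q.2) 2
      (spaceTimeMeasure T)) l (𝓝 0) := by
  set V : ℝ≥0∞ := timeMeasure T Set.univ with hV
  have hVt : V ≠ ⊤ := measure_ne_top _ _
  have hm := fun j => (hLH j).memLp_two
  have hEfin : ∀ {f : Torus2 → Plane}, MemLp f 2 volume → 2 * kineticEnergy f * V ≠ ⊤ :=
    fun {f} hf => by
      rw [two_mul_kineticEnergy]
      exact ENNReal.mul_ne_top (ENNReal.pow_ne_top hf.2.ne) hVt
  have hup : ∀ j, ‖(hm j).toLp‖ ^ 2 ≤ (2 * kineticEnergy (u₀ν j) * V).toReal := fun j => by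
    rw [Lp.norm_toLp, ← ENNReal.toReal_pow, ← lintegral_two_mul_kineticEnergy (hm j).1]
    refine ENNReal.toReal_mono (hEfin (hLH j).init_memLp) ?_
    rw [hV, ← lintegral_const]
    exact lintegral_mono_ae ((hLH j).ae_kineticEnergy_le.mono fun t ht => mul_le_mul' le_rfl ht)
  have hu2 : ‖hu.toLp‖ ^ 2 = (2 * kineticEnergy u₀ * V).toReal := by
    rw [Lp.norm_toLp, ← ENNReal.toReal_pow, ← lintegral_two_mul_kineticEnergy hu.1, hV,
      ← lintegral_const]
    congr 1
    exact lintegral_congr_ae (hE.mono fun t ht => by simp only [ht])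
  have hinner : ∀ {w : ℝ × Torus2 → Plane} (hw : MemLp w 2 (spaceTimeMeasure T)),
      inner ℝ hw.toLp hu.toLp = ∫ q, inner ℝ (w q) (u q.1 q.2) ∂spaceTimeMeasure T := fun hw => by
    rw [L2.inner_def]
    refine integral_congr_ae ?_
    filter_upwards [hw.coeFn_toLp, hu.coeFn_toLp] with q h1 h2
    rw [h1, h2]
  have hlim1 : Tendsto (fun j => inner ℝ (hm j).toLp hu.toLp) l (𝓝 (‖hu.toLp‖ ^ 2)) := by
    rw [← real_inner_self_eq_norm_sq]
    simp only [hinner]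
    exact hu_lim _ hu
  have hlim2 : Tendsto (fun j => (2 * kineticEnergy (u₀ν j) * V).toReal) l
      (𝓝 (‖hu.toLp‖ ^ 2)) := by
    rw [hu2]
    refine (ENNReal.tendsto_toReal (hEfin hu₀)).comp ?_
    exact ENNReal.Tendsto.mul_const (ENNReal.Tendsto.const_mul
      (tendsto_kineticEnergy (fun j => (hLH j).init_memLp.1) hu₀ hu₀_lim)
      (Or.inr ENNReal.ofNat_ne_top)) (Or.inr hVt)
  -- In the expansion of the square, the first term is replaced by its upper bound from the data;
  -- all three terms then have limits, and these cancel.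
  have hsq : Tendsto (fun j => ‖(hm j).toLp - hu.toLp‖ ^ 2) l (𝓝 0) := by
    have hlim := (hlim2.sub (hlim1.const_mul 2)).add_const (‖hu.toLp‖ ^ 2)
    rw [show ‖hu.toLp‖ ^ 2 - 2 * ‖hu.toLp‖ ^ 2 + ‖hu.toLp‖ ^ 2 = 0 by ring] at hlim
    refine squeeze_zero (fun j => by positivity) (fun j => ?_) hlim
    rw [norm_sub_sq_real]
    gcongr
    exact hup j
  have hnorm : Tendsto (fun j => ‖(hm j).toLp - hu.toLp‖) l (𝓝 0) := by
    have := (Real.continuous_sqrt.tendsto 0).comp hsq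
    simpa [Function.comp_def, Real.sqrt_sq] using this
  have henorm := (ENNReal.continuous_ofReal.tendsto 0).comp hnorm
  rw [ENNReal.ofReal_zero] at henorm
  refine henorm.congr fun j => ?_
  rw [Function.comp_apply, ofReal_norm, ← MemLp.toLp_sub, Lp.enorm_toLp]
  rfl

theorem tendsto_normLpL2_of_energy_conservation
    (hLH : ∀ j, IsLerayHopf (ν j) T (u₀ν j) (uν j) (Duν j)) (hu₀ : MemLp u₀ 2 volume)
    (hu₀_lim : Tendsto (fun j => eLpNorm (fun x => u₀ν j x - u₀ x) 2 volume) l (𝓝 0))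
    (hu : MemLp (fun q : ℝ × Torus2 => u q.1 q.2) 2 (spaceTimeMeasure T))
    (hu_lim : WeakTendstoL2 T l uν u)
    (hE : ∀ᵐ t ∂timeMeasure T, kineticEnergy (u t) = kineticEnergy u₀) {p : ℝ≥0∞} (hp1 : 1 ≤ p)
    (hp : p ≠ ⊤) :
    Tendsto (fun j => normLpL2 p T (fun t x => uν j t x - u t x)) l (𝓝 0) := by
  have hmeas : ∀ j, AEStronglyMeasurable (fun q : ℝ × Torus2 => uν j q.1 q.2 - u q.1 q.2)
      (spaceTimeMeasure T) := fun j => (hLH j).memLp_two.1.sub hu.1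
  have h2 := tendsto_eLpNorm_spaceTime hLH hu₀ hu₀_lim hu hu_lim hE
  have hinit := tendsto_eLpNorm_of_tendsto_sub one_le_two (fun j => (hLH j).init_memLp.1) hu₀
    hu₀_lim
  -- Eventually the norm of the datum is below `‖u₀‖ + 1`, which bounds `u^{ν_j}(t)`, while energy
  -- conservation bounds `u(t)` by `‖u₀‖`.
  refine tendsto_eLpNorm_of_bounded (K := (eLpNorm u₀ 2 volume + 1) + eLpNorm u₀ 2 volume)
    (fun j => aemeasurable_eLpNorm_slice (w := fun t x => uν j t x - u t x) (hmeas j))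
    (ENNReal.add_ne_top.2 ⟨ENNReal.add_ne_top.2 ⟨hu₀.2.ne, ENNReal.one_ne_top⟩, hu₀.2.ne⟩) ?_
    (h2.congr fun j => (normLpL2_two (w := fun t x => uν j t x - u t x) (hmeas j)).symm) hp1 hp
  filter_upwards [hinit.eventually (gt_mem_nhds (ENNReal.lt_add_right hu₀.2.ne one_ne_zero))]
    with j hj
  filter_upwards [(hLH j).ae_kineticEnergy_le, hE, ae_memLp_slice (hLH j).memLp_two,
    ae_memLp_slice hu] with t h1 h2 h3 h4
  calc eLpNorm (uν j t - u t) 2 volume ≤ eLpNorm (uν j t) 2 volume + eLpNorm (u t) 2 volume :=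
        eLpNorm_sub_le h3.1 h4.1 one_le_two
    _ ≤ _ := add_le_add ((eLpNorm_le_of_kineticEnergy_le h1).trans hj.le)
        (eLpNorm_le_of_kineticEnergy_le h2.le)

theorem energy_conservation_of_tendsto_normLpL2 [l.NeBot] [l.IsCountablyGenerated] (hT : 0 < T)
    (hν_pos : ∀ j, 0 < ν j) (hLH : ∀ j, IsLerayHopf (ν j) T (u₀ν j) (uν j) (Duν j))
    (hu₀ : MemLp u₀ 2 volume)
    (hu₀_lim : Tendsto (fun j => eLpNorm (fun x => u₀ν j x - u₀ x) 2 volume) l (𝓝 0))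
    (h_diss : Tendsto (fun j => dissipation (ν j) T (Duν j)) l (𝓝 0))
    (hu : MemLp (fun q : ℝ × Torus2 => u q.1 q.2) 2 (spaceTimeMeasure T))
    (h : Tendsto (fun j => normLpL2 1 T (fun t x => uν j t x - u t x)) l (𝓝 0)) :
    ∀ᵐ t ∂timeMeasure T, kineticEnergy (u t) = kineticEnergy u₀ := by
  -- Almost everywhere convergence is only available along a sequence; countable generation of `l`
  -- provides one.
  obtain ⟨js, hjs⟩ := exists_seq_tendsto l
  have hmeas : ∀ n, AEMeasurable (fun t => eLpNorm (fun x => uν (js n) t x - u t x) 2 volume)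
      (timeMeasure T) := fun n => aemeasurable_eLpNorm_slice
        (w := fun t x => uν (js n) t x - u t x) ((hLH (js n)).memLp_two.1.sub hu.1)
  have h1 : Tendsto (fun n => ∫⁻ t, eLpNorm (fun x => uν (js n) t x - u t x) 2 volume
      ∂timeMeasure T) atTop (𝓝 0) := by
    refine (h.comp hjs).congr fun n => ?_
    simp [normLpL2, eLpNorm_one_eq_lintegral_enorm]
  obtain ⟨ns, hns, hae⟩ := exists_subseq_tendsto_ae_zero hmeas h1
  have hlim : Tendsto (fun k => js (ns k)) atTop l := hjs.comp hns.tendsto_atTop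
  have hE₀ := tendsto_kineticEnergy (fun k => (hLH (js (ns k))).init_memLp.1) hu₀
    (hu₀_lim.comp hlim)
  have hup := ae_all_iff.2 fun k => (hLH (js (ns k))).ae_kineticEnergy_le
  have hlow := ae_all_iff.2 fun k => (hLH (js (ns k))).ae_le_energy hT (hν_pos _)
  have hsl := ae_all_iff.2 fun k => ae_memLp_slice (hLH (js (ns k))).memLp_two
  have hmem : ∀ᵐ t ∂timeMeasure T, t ∈ Set.Icc 0 T := ae_restrict_mem measurableSet_Icc
  filter_upwards [hae, hup, hlow, hsl, ae_memLp_slice hu, hmem] with t ht hupt hlowt hslt hut htT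
  have hEt := tendsto_kineticEnergy (fun k => (hslt k).1) hut ht
  -- The upper bound is the limit of the energy inequality; the lower one is the limit of its
  -- reverse, with dissipation up to `t` bounded by that up to `T`.
  refine le_antisymm (le_of_tendsto_of_tendsto' hEt hE₀ hupt) ?_
  have hsum := hEt.add (h_diss.comp hlim)
  rw [add_zero] at hsum
  exact le_of_tendsto_of_tendsto' hE₀ hsum fun k =>
    (hlowt k).trans (add_le_add le_rfl (dissipation_mono _ _ htT.2))

end

theorem proposition6p1 {ι : Type*} (l : Filter ι) [l.NeBot] [l.IsCountablyGenerated]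
    (T : ℝ) (hT : 0 < T)
    (ν : ι → ℝ) (hν_pos : ∀ j, 0 < ν j) (hν : Tendsto ν l (𝓝 0))
    (u₀ν : ι → Torus2 → Plane) (u₀ : Torus2 → Plane)
    (uν : ι → ℝ → Torus2 → Plane) (Duν : ι → ℝ → Torus2 → Fin 2 → Plane)
    (u : ℝ → Torus2 → Plane)
    (hLH : ∀ j, IsLerayHopf (ν j) T (u₀ν j) (uν j) (Duν j))
    (hu₀ : MemLp u₀ 2 volume)
    (hu₀_lim : Tendsto (fun j => eLpNorm (fun x => u₀ν j x - u₀ x) 2 volume) l (𝓝 0))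
    (h_no_anomalous : limsup (fun j => dissipation (ν j) T (Duν j)) l = 0)
    (hu : MemLp (fun q : ℝ × Torus2 => u q.1 q.2) 2 (spaceTimeMeasure T))
    (hu_lim : WeakTendstoL2 T l uν u) :
    ((∀ᵐ t ∂timeMeasure T, kineticEnergy (u t) = kineticEnergy u₀) →
      ∀ p : ℝ≥0∞, 1 ≤ p → p ≠ ⊤ →
        Tendsto (fun j => normLpL2 p T (fun t x => uν j t x - u t x)) l (𝓝 0)) ∧
    (Tendsto (fun j => normLpL2 1 T (fun t x => uν j t x - u t x)) l (𝓝 0) →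
      ∀ᵐ t ∂timeMeasure T, kineticEnergy (u t) = kineticEnergy u₀) := by
  refine ⟨fun hE p hp1 hp =>
    tendsto_normLpL2_of_energy_conservation hLH hu₀ hu₀_lim hu hu_lim hE hp1 hp, fun h => ?_⟩
  refine energy_conservation_of_tendsto_normLpL2 hT hν_pos hLH hu₀ hu₀_lim ?_ hu h
  exact tendsto_of_le_liminf_of_limsup_le zero_le h_no_anomalous.le
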